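/- There is a deterministic parallel algorithm (a single program for a synchronous work-depth machine with shared memory in which, of several concurrent writes to one cell, an arbitrary one succeeds) and there are constants $C,c\in\mathbb N$ such that the following holds. Let $G=(V,E)$ be any simple graph with $n=|V|\ge 1$ nodes and $m=|E|$ edges, given to the algorithm as adjacency lists (in any order), let $w(e)\ge 0$ be a real weight for each edge $e\in E$, stored in one memory cell, and let $\varepsilon>0$ be real. For every resolution of the write conflicts, the algorithm halts and outputs a set $S\subseteq V$ with $$\sum_{\{u,v\}\in E,\ u\in S,\ v\in V\setminus S} w(\{u,v\})\ \ge\ \Big(\tfrac12-\varepsilon\Big)\sum_{e\in E} w(e).$$ It uses work (total number of elementary operations of all processors) at most $C\,(m+n)\cdot\max\{1,\log\log n\}$ (the maximum being read as $1$ when $n=1$) and depth (number of synchronous parallel rounds) at most $C\,(1+\frac{\log n}{\varepsilon})^{c}$. Every integer that the algorithm stores is at most $C n^{c}$ (words of $O(\log n)$ bits). On weights and $\varepsilon$ it only uses addition, subtraction and comparison, together with the number $1$, and every number so stored is at most $C n^{c}\,(1+\varepsilon+\sum_{e\in E} w(e))$ in absolute value. -/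

import Mathlib

open scoped BigOperators

/-!
# A synchronous work-depth machine (arbitrary CRCW PRAM)

Shared memory consists of arrays of integer words and arrays of numbers.  A program is a sequential
control structure around parallel instructions.  In one parallel instruction the processors
`0, 1, …, k - 1` all read the old memory, compute, and then write simultaneously; if several
processors write to one cell then an arbitrary one of them succeeds.  Work is the total number of
elementary operations of all processors, depth is the number of synchronous elementary rounds.
Integer words are bounded (an overflow has no execution).  Numbers (for weights) admit only addition,
subtraction and comparison, and are bounded in magnitude too, so that on inputs that are fixed-point
words they remain fixed-point words.
-/

namespace WorkDepth

/-- Shared memory together with the two cost counters. `ints A x` and `nums A x` are the `x`-th cells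
of the integer array `A` and of the number array `A`. -/
structure State where
  ints : ℕ → ℕ → ℕ
  nums : ℕ → ℕ → ℝ
  work : ℕ
  depth : ℕ

/-- Elementary operations on integer words. -/
inductive BinOp where
  | add | sub | mul | div | mod | lt | eq

/-- Subtraction is truncated at `0`; comparisons return `1` (true) or `0` (false). -/
def BinOp.eval : BinOp → ℕ → ℕ → ℕ
  | .add, a, b => a + b
  | .sub, a, b => a - b
  | .mul, a, b => a * b
  | .div, a, b => a / b
  | .mod, a, b => a % b
  | .lt, a, b => if a < b then 1 else 0
  | .eq, a, b => if a = b then 1 else 0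

/-- Integer expressions that a processor evaluates. A program contains finitely many of them, so each
evaluation takes a constant number of elementary operations on a constant number of words. -/
inductive Term where
  /-- a constant of the program -/
  | const (c : ℕ)
  /-- the index of the processor -/
  | idx
  /-- the cell of the integer array `A` with the given address -/
  | get (A : ℕ) (addr : Term)
  | bin (op : BinOp) (a b : Term)
  /-- `a` if `c` is nonzero, and `b` otherwise -/
  | ite (c a b : Term)
  /-- `1` if cell `a` of the number array `A` is less than cell `b` of the number array `B`, else `0` -/
  | numLt (A : ℕ) (a : Term) (B : ℕ) (b : Term)

open Classical in
/-- Value of an expression for processor `i` in state `s`. -/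
noncomputable def Term.eval (s : State) (i : ℕ) : Term → ℕ
  | .const c => c
  | .idx => i
  | .get A a => s.ints A (a.eval s i)
  | .bin op a b => op.eval (a.eval s i) (b.eval s i)
  | .ite c a b => if c.eval s i ≠ 0 then a.eval s i else b.eval s i
  | .numLt A a B b => if s.nums A (a.eval s i) < s.nums B (b.eval s i) then 1 else 0

/-- Number of elementary operations in an expression. -/
def Term.cost : Term → ℕ
  | .const _ => 1
  | .idx => 1
  | .get _ a => a.cost + 1
  | .bin _ a b => a.cost + b.cost + 1
  | .ite c a b => c.cost + a.cost + b.cost + 1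
  | .numLt _ a _ b => a.cost + b.cost + 1

/-- Number-valued expressions: only reading, addition and subtraction. -/
inductive NumTerm where
  | get (A : ℕ) (addr : Term)
  | add (a b : NumTerm)
  | sub (a b : NumTerm)

noncomputable def NumTerm.eval (s : State) (i : ℕ) : NumTerm → ℝ
  | .get A a => s.nums A (a.eval s i)
  | .add a b => a.eval s i + b.eval s i
  | .sub a b => a.eval s i - b.eval s i

def NumTerm.cost : NumTerm → ℕ
  | .get _ a => a.cost + 1
  | .add a b => a.cost + b.cost + 1
  | .sub a b => a.cost + b.cost + 1

/-- Programs. `intStep A count guard addr val`: every processor `i < count` whose `guard` is nonzero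
writes `val` into cell `addr` of the integer array `A`, all simultaneously; `numStep` does so for a
number array. With `count = 1` this is an ordinary sequential assignment. -/
inductive Cmd where
  | skip
  | intStep (A : ℕ) (count guard addr val : Term)
  | numStep (A : ℕ) (count guard addr : Term) (val : NumTerm)
  | seq (c d : Cmd)
  | ite (b : Term) (c d : Cmd)
  | loop (b : Term) (c : Cmd)

/-- A resolution of all write conflicts: `pick t x S` is the processor that succeeds when, at time
`t`, exactly the processors in `S` write to the cell with address `x`. -/
structure Arbiter where
  pick : ℕ → ℕ → Finset ℕ → ℕ
  pick_mem : ∀ t x S, S.Nonempty → pick t x S ∈ S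

/-- Bounds on the words and numbers that may be stored, and the resolution of write conflicts. -/
structure Machine where
  wordBound : ℕ
  numBound : ℝ
  arbiter : Arbiter

/-- The processors that write to address `x`. -/
noncomputable def writers (s : State) (count guard addr : Term) (x : ℕ) : Finset ℕ :=
  (Finset.range (count.eval s 0)).filter fun i => guard.eval s i ≠ 0 ∧ addr.eval s i = x

open Classical in
/-- Effect of the parallel instruction `Cmd.intStep`. -/
noncomputable def State.intStep (M : Machine) (s : State) (A : ℕ)
    (count guard addr val : Term) : State where
  ints B x :=
    if B = A ∧ (writers s count guard addr x).Nonempty then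
      val.eval s (M.arbiter.pick s.depth x (writers s count guard addr x))
    else s.ints B x
  nums := s.nums
  work := s.work + count.cost + count.eval s 0 * (guard.cost + addr.cost + val.cost + 1)
  depth := s.depth + count.cost + (guard.cost + addr.cost + val.cost + 1)

open Classical in
/-- Effect of the parallel instruction `Cmd.numStep`. -/
noncomputable def State.numStep (M : Machine) (s : State) (A : ℕ)
    (count guard addr : Term) (val : NumTerm) : State where
  ints := s.ints
  nums B x :=
    if B = A ∧ (writers s count guard addr x).Nonempty then
      val.eval s (M.arbiter.pick s.depth x (writers s count guard addr x))
    else s.nums B x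
  work := s.work + count.cost + count.eval s 0 * (guard.cost + addr.cost + val.cost + 1)
  depth := s.depth + count.cost + (guard.cost + addr.cost + val.cost + 1)

/-- Cost of evaluating a test, paid by the control. -/
def State.charge (s : State) (b : Term) : State :=
  { s with work := s.work + b.cost, depth := s.depth + b.cost }

/-- `Exec M c s s'`: started in state `s`, the program `c` halts in state `s'`, and no written value
exceeded the bounds of the machine. -/
inductive Exec (M : Machine) : Cmd → State → State → Prop where
  | skip (s : State) : Exec M .skip s s
  | intStep (s : State) (A : ℕ) (count guard addr val : Term)
      (h : ∀ i < count.eval s 0, guard.eval s i ≠ 0 → val.eval s i ≤ M.wordBound) :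
      Exec M (.intStep A count guard addr val) s (s.intStep M A count guard addr val)
  | numStep (s : State) (A : ℕ) (count guard addr : Term) (val : NumTerm)
      (h : ∀ i < count.eval s 0, guard.eval s i ≠ 0 → |val.eval s i| ≤ M.numBound) :
      Exec M (.numStep A count guard addr val) s (s.numStep M A count guard addr val)
  | seq {c d : Cmd} {s s' s'' : State} (h : Exec M c s s') (h' : Exec M d s' s'') :
      Exec M (.seq c d) s s''
  | iteTrue {b : Term} {c d : Cmd} {s s' : State} (hb : b.eval s 0 ≠ 0)
      (h : Exec M c (s.charge b) s') : Exec M (.ite b c d) s s'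
  | iteFalse {b : Term} {c d : Cmd} {s s' : State} (hb : b.eval s 0 = 0)
      (h : Exec M d (s.charge b) s') : Exec M (.ite b c d) s s'
  | loopTrue {b : Term} {c : Cmd} {s s' s'' : State} (hb : b.eval s 0 ≠ 0)
      (h : Exec M c (s.charge b) s') (h' : Exec M (.loop b c) s' s'') :
      Exec M (.loop b c) s s''
  | loopFalse {b : Term} {c : Cmd} {s : State} (hb : b.eval s 0 = 0) :
      Exec M (.loop b c) s (s.charge b)

/-- `adj` lists the neighbours of each vertex, in any order and without repetition. -/
def IsAdjacencyLists {n : ℕ} (G : SimpleGraph (Fin n)) (adj : Fin n → List (Fin n)) : Prop :=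
  ∀ v, (adj v).Nodup ∧ ∀ u, u ∈ adj v ↔ G.Adj v u

/-- Initial memory for a weighted graph on `{0, …, n - 1}` given by adjacency lists, and `ε`:
* integer array `0` holds `n`;
* integer array `1` holds, at `i ≤ n`, the start of the list of vertex `i` in the concatenation of all
  adjacency lists (at `n`: the total length);
* integer array `2` holds the concatenated adjacency lists;
* number array `0` holds the weights of the corresponding edges;
* number array `1` holds `ε` and `1`.
All other cells are `0`. -/
def inputState {n : ℕ} (adj : Fin n → List (Fin n)) (w : Sym2 (Fin n) → ℝ) (ε : ℝ) : State where
  ints A x :=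
    if A = 0 ∧ x = 0 then n
    else if A = 1 ∧ x ≤ n then ((List.ofFn adj).take x).flatten.length
    else if A = 2 then ((List.ofFn adj).flatten.map Fin.val).getD x 0
    else 0
  nums A x :=
    if A = 0 then (List.ofFn fun v => (adj v).map fun u => w s(v, u)).flatten.getD x 0
    else if A = 1 ∧ x = 0 then ε
    else if A = 1 ∧ x = 1 then 1
    else 0
  work := 0
  depth := 0

/-- The vertex set that a final state represents: integer array `3` holds its indicator. -/
def outputSet (n : ℕ) (s : State) : Finset (Fin n) :=
  Finset.univ.filter fun v => s.ints 3 v = 1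

end WorkDepth

open Classical in
/-- Total weight of the edges of `G` between `S` and its complement. -/
noncomputable def cutWeight {n : ℕ} (G : SimpleGraph (Fin n)) [DecidableRel G.Adj]
    (w : Sym2 (Fin n) → ℝ) (S : Finset (Fin n)) : ℝ :=
  ∑ e ∈ G.edgeFinset.filter (fun e => ∃ u ∈ S, ∃ v ∉ S, e = s(u, v)), w e

/-!
# A linear-work parallel algorithm for cutting half of the weight

Vertex `v` gets the label `⟨r, v⟩`, the inner product over `𝔽₂` of the binary digits. Whether the edge
`uv` is cut is decided by the digit of `r` at the lowest position where `u` and `v` differ, once the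
higher digits are known. The digits are chosen from the highest to the lowest, each so that at least
half of the weight of the edges that it decides is cut. The edges are grouped by position with a
counting sort, so that every edge is touched in one level only.
-/

namespace WorkDepth

/-! Labelling `v` by `⟨r, v⟩` over `𝔽₂` with random `r` cuts every edge with probability one half,
and conditional expectations remove the randomness one bit of `r` at a time. Let the key of an edge
`uv` be the lowest bit position where `u` and `v` differ, which is the `2`-adic valuation of `|u -
v|`. Fix the bits of `r` from the top. At stage `j` the label of `v` depends only on `v / 2 ^ j`.
Passing from stage `j + 1` to `j` does not affect whether an edge of key above `j` is cut, because
its ends agree in bit `j`. For the edges of key exactly `j`, the new bit of `r` either keeps or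
flips the status of all of them together. So uncut minus cut weight of that group can be made
nonpositive by looking at one sum (`sum_signedWeight_refine`). At stage `0` all edges are covered,
hence at least half of the weight is cut (`half_le_cutWeight`).

Linear work comes from touching each edge only at the stage of its key. Let `N = n + 2m` and `4N ≤ 2
^ D < 8N`. Keys are below `D`, so a counting sort with blocks of length `D` groups the adjacency
entries with `O(N)` work and `O(D)` depth (`reaches_items`, `reaches_scan`, `reaches_sort`). The
group sizes then telescope to `N`, and the label tables have `n / 2 ^ j + 1` cells, a geometric sum
(`reaches_level`, `reaches_levels`). Each of the `D` stages sums its group in depth `O(D)`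
(`reaches_reduce`), so the total depth is `O(D ^ 2)`.

The accuracy `ε` matters only for depth: below `1` one has `log n ≤ log n / ε`, and from `1` on the
required weight is nonpositive, so the program stops at once. -/

instance : Add Term := ⟨.bin .add⟩
instance : Sub Term := ⟨.bin .sub⟩
instance : Mul Term := ⟨.bin .mul⟩
instance : Div Term := ⟨.bin .div⟩
instance : Mod Term := ⟨.bin .mod⟩

/-- The scalar stored in the first cell of an integer array. -/
def Term.reg (A : ℕ) : Term := .get A (.const 0)

/-! ### Values and costs of expressions -/

section eval
variable (s : State) (i : ℕ) (a b c : Term)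

@[simp] theorem Term.eval_add : (a + b).eval s i = a.eval s i + b.eval s i := rfl
@[simp] theorem Term.eval_sub : (a - b).eval s i = a.eval s i - b.eval s i := rfl
@[simp] theorem Term.eval_mul : (a * b).eval s i = a.eval s i * b.eval s i := rfl
@[simp] theorem Term.eval_div : (a / b).eval s i = a.eval s i / b.eval s i := rfl
@[simp] theorem Term.eval_mod : (a % b).eval s i = a.eval s i % b.eval s i := rfl
@[simp] theorem Term.eval_lt :
    (Term.bin .lt a b).eval s i = if a.eval s i < b.eval s i then 1 else 0 := rfl
@[simp] theorem Term.eval_eq :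
    (Term.bin .eq a b).eval s i = if a.eval s i = b.eval s i then 1 else 0 := rfl
@[simp] theorem Term.eval_const (k : ℕ) : (Term.const k).eval s i = k := rfl
@[simp] theorem Term.eval_idx : Term.idx.eval s i = i := rfl
@[simp] theorem Term.eval_get (A : ℕ) : (Term.get A a).eval s i = s.ints A (a.eval s i) := rfl
@[simp] theorem Term.eval_reg (A : ℕ) : (Term.reg A).eval s i = s.ints A 0 := rfl
@[simp] theorem Term.eval_ite :
    (Term.ite c a b).eval s i = if c.eval s i = 0 then b.eval s i else a.eval s i := by
  simp only [Term.eval]; split_ifs <;> simp_all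
open Classical in
@[simp] theorem Term.eval_numLt (A B : ℕ) :
    (Term.numLt A a B b).eval s i =
      if s.nums A (a.eval s i) < s.nums B (b.eval s i) then 1 else 0 := by
  simp [Term.eval]

@[simp] theorem Term.cost_add : (a + b).cost = a.cost + b.cost + 1 := rfl
@[simp] theorem Term.cost_sub : (a - b).cost = a.cost + b.cost + 1 := rfl
@[simp] theorem Term.cost_mul : (a * b).cost = a.cost + b.cost + 1 := rfl
@[simp] theorem Term.cost_div : (a / b).cost = a.cost + b.cost + 1 := rfl
@[simp] theorem Term.cost_mod : (a % b).cost = a.cost + b.cost + 1 := rfl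
@[simp] theorem Term.cost_bin (o : BinOp) : (Term.bin o a b).cost = a.cost + b.cost + 1 := rfl
@[simp] theorem Term.cost_const (k : ℕ) : (Term.const k).cost = 1 := rfl
@[simp] theorem Term.cost_idx : Term.idx.cost = 1 := rfl
@[simp] theorem Term.cost_get (A : ℕ) : (Term.get A a).cost = a.cost + 1 := rfl
@[simp] theorem Term.cost_reg (A : ℕ) : (Term.reg A).cost = 2 := rfl
@[simp] theorem Term.cost_ite : (Term.ite c a b).cost = c.cost + a.cost + b.cost + 1 := rfl
@[simp] theorem Term.cost_numLt (A B : ℕ) : (Term.numLt A a B b).cost = a.cost + b.cost + 1 := rfl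

variable (x y : NumTerm)
@[simp] theorem NumTerm.eval_get (A : ℕ) : (NumTerm.get A a).eval s i = s.nums A (a.eval s i) := rfl
@[simp] theorem NumTerm.eval_add : (NumTerm.add x y).eval s i = x.eval s i + y.eval s i := rfl
@[simp] theorem NumTerm.eval_sub : (NumTerm.sub x y).eval s i = x.eval s i - y.eval s i := rfl
@[simp] theorem NumTerm.cost_get (A : ℕ) : (NumTerm.get A a).cost = a.cost + 1 := rfl
@[simp] theorem NumTerm.cost_add : (NumTerm.add x y).cost = x.cost + y.cost + 1 := rfl
@[simp] theorem NumTerm.cost_sub : (NumTerm.sub x y).cost = x.cost + y.cost + 1 := rfl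

end eval

/-! ### Program logic with work and depth budgets -/

/-- From `s` the program `c` halts within the given additional work `W` and depth `D`, and the final
memory satisfies `Q`. -/
def Reaches (M : Machine) (c : Cmd) (s : State) (W D : ℕ)
    (Q : (ℕ → ℕ → ℕ) → (ℕ → ℕ → ℝ) → Prop) : Prop :=
  ∃ s', Exec M c s s' ∧ s'.work ≤ s.work + W ∧ s'.depth ≤ s.depth + D ∧ Q s'.ints s'.nums

variable {M : Machine} {s : State}

theorem Reaches.mono {c : Cmd} {W W' D D' : ℕ} {Q Q' : (ℕ → ℕ → ℕ) → (ℕ → ℕ → ℝ) → Prop}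
    (h : Reaches M c s W D Q) (hW : W ≤ W') (hD : D ≤ D') (hQ : ∀ I X, Q I X → Q' I X) :
    Reaches M c s W' D' Q' := by
  obtain ⟨s', h1, h2, h3, h4⟩ := h
  exact ⟨s', h1, by omega, by omega, hQ _ _ h4⟩

theorem Reaches.seq {c d : Cmd} {W₁ W₂ D₁ D₂ : ℕ} {Q₁ Q : (ℕ → ℕ → ℕ) → (ℕ → ℕ → ℝ) → Prop}
    (h : Reaches M c s W₁ D₁ Q₁) (h' : ∀ s' : State, Q₁ s'.ints s'.nums → Reaches M d s' W₂ D₂ Q) :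
    Reaches M (.seq c d) s (W₁ + W₂) (D₁ + D₂) Q := by
  obtain ⟨s', h1, h2, h3, h4⟩ := h
  obtain ⟨s'', k1, k2, k3, k4⟩ := h' s' h4
  exact ⟨s'', .seq h1 k1, by omega, by omega, k4⟩

/-- Every writer to a cell writes the value that `f` assigns to its address, so concurrent writers
agree and the resulting memory does not depend on the arbiter. -/
theorem reaches_intStep (A : ℕ) (count guard addr val : Term) {k : ℕ} (hk : count.eval s 0 = k)
    (f : ℕ → ℕ)
    (hw : ∀ i < k, guard.eval s i ≠ 0 →
      val.eval s i = f (addr.eval s i) ∧ val.eval s i ≤ M.wordBound)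
    (hn : ∀ x, (∀ i < k, guard.eval s i ≠ 0 → addr.eval s i ≠ x) → f x = s.ints A x) :
    Reaches M (.intStep A count guard addr val) s
      (count.cost + k * (guard.cost + addr.cost + val.cost + 1))
      (count.cost + (guard.cost + addr.cost + val.cost + 1))
      (fun I X => I = Function.update s.ints A f ∧ X = s.nums) := by
  subst hk
  refine ⟨_, .intStep s A count guard addr val fun i hi hg => (hw i hi hg).2, ?_, ?_, ?_, rfl⟩
  · simp [State.intStep, add_assoc]
  · simp [State.intStep, add_assoc]
  · funext B x
    simp only [State.intStep]
    by_cases hB : B = A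
    · subst hB
      rw [Function.update_self]
      split_ifs with h
      · have h1 := M.arbiter.pick_mem s.depth x _ h.2
        simp only [writers, Finset.mem_filter, Finset.mem_range] at h1
        rw [writers, (hw _ h1.1 h1.2.1).1, h1.2.2]
      · rw [hn x]
        intro i hi hg hx
        exact h ⟨rfl, i, by simp [writers, hi, hg, hx]⟩
    · simp [hB]

theorem reaches_numStep (A : ℕ) (count guard addr : Term) (val : NumTerm) {k : ℕ}
    (hk : count.eval s 0 = k) (f : ℕ → ℝ)
    (hw : ∀ i < k, guard.eval s i ≠ 0 →
      val.eval s i = f (addr.eval s i) ∧ |val.eval s i| ≤ M.numBound)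
    (hn : ∀ x, (∀ i < k, guard.eval s i ≠ 0 → addr.eval s i ≠ x) → f x = s.nums A x) :
    Reaches M (.numStep A count guard addr val) s
      (count.cost + k * (guard.cost + addr.cost + val.cost + 1))
      (count.cost + (guard.cost + addr.cost + val.cost + 1))
      (fun I X => I = s.ints ∧ X = Function.update s.nums A f) := by
  subst hk
  refine ⟨_, .numStep s A count guard addr val fun i hi hg => (hw i hi hg).2, ?_, ?_, rfl, ?_⟩
  · simp [State.numStep, add_assoc]
  · simp [State.numStep, add_assoc]
  · funext B x
    simp only [State.numStep]
    by_cases hB : B = A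
    · subst hB
      rw [Function.update_self]
      split_ifs with h
      · have h1 := M.arbiter.pick_mem s.depth x _ h.2
        simp only [writers, Finset.mem_filter, Finset.mem_range] at h1
        rw [writers, (hw _ h1.1 h1.2.1).1, h1.2.2]
      · rw [hn x]
        intro i hi hg hx
        exact h ⟨rfl, i, by simp [writers, hi, hg, hx]⟩
    · simp [hB]

/-- Assignment to a scalar. -/
def Cmd.assign (A : ℕ) (t : Term) : Cmd := .intStep A (.const 1) (.const 1) (.const 0) t

theorem reaches_assign (A : ℕ) (t : Term) {v : ℕ} (hv : t.eval s 0 = v) (hb : v ≤ M.wordBound) :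
    Reaches M (.assign A t) s (t.cost + 4) (t.cost + 4)
      (fun I X => I = Function.update s.ints A (Function.update (s.ints A) 0 v) ∧ X = s.nums) := by
  refine (reaches_intStep (k := 1) A _ _ _ t rfl (Function.update (s.ints A) 0 v) ?_ ?_).mono
    ?_ ?_ fun I X h => h
  · intro i hi _
    obtain rfl : i = 0 := by omega
    simp [hv, hb]
  · intro x hx
    have := hx 0 (by simp) (by simp)
    simp at this
    simp [Function.update_of_ne (Ne.symm this)]
  · simp; omega
  · simp; omega

theorem reaches_assign_seq {A : ℕ} {t : Term} {d : Cmd} (v : ℕ) (W₂ D₂ : ℕ) {W D : ℕ}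
    {Q : (ℕ → ℕ → ℕ) → (ℕ → ℕ → ℝ) → Prop} (hv : t.eval s 0 = v) (hb : v ≤ M.wordBound)
    (hW : t.cost + 4 + W₂ ≤ W) (hD : t.cost + 4 + D₂ ≤ D)
    (h : ∀ s' : State,
      s'.ints = Function.update s.ints A (Function.update (s.ints A) 0 v) → s'.nums = s.nums →
      Reaches M d s' W₂ D₂ Q) :
    Reaches M (.seq (.assign A t) d) s W D Q :=
  ((reaches_assign A t hv hb).seq fun s' hs' => h s' hs'.1 hs'.2).mono hW hD fun _ _ h => h

/-- Processors `i < count` write to the consecutive cells `base + i`. -/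
def Cmd.fill (A : ℕ) (count base val : Term) : Cmd :=
  .intStep A count (.const 1) (base + .idx) val

theorem reaches_fill (A : ℕ) (count base val : Term) {k o : ℕ} (hk : count.eval s 0 = k)
    (ho : ∀ i, base.eval s i = o) (v : ℕ → ℕ)
    (hv : ∀ i < k, val.eval s i = v i) (hb : ∀ i < k, v i ≤ M.wordBound) :
    Reaches M (.fill A count base val) s
      (count.cost + k * (base.cost + val.cost + 4)) (count.cost + base.cost + val.cost + 4)
      (fun I X => I = Function.update s.ints A
        (fun x => if o ≤ x ∧ x < o + k then v (x - o) else s.ints A x) ∧ X = s.nums) := by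
  refine (reaches_intStep A count _ _ val hk _ ?_ ?_).mono ?_ ?_ fun I X h => h
  · intro i hi _
    simp [ho, hi, hv i hi, hb i hi]
  · intro x hx
    rw [if_neg]
    rintro ⟨h1, h2⟩
    refine hx (x - o) (by omega) (by simp) ?_
    simp [ho]; omega
  · refine le_of_eq ?_
    simp only [Term.cost_add, Term.cost_const, Term.cost_idx]; ring
  · simp; omega

theorem reaches_fill_seq {A : ℕ} {count base val : Term} {d : Cmd} (v : ℕ → ℕ) (k o : ℕ)
    (W₂ D₂ : ℕ) {W D : ℕ} {Q : (ℕ → ℕ → ℕ) → (ℕ → ℕ → ℝ) → Prop}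
    (hk : count.eval s 0 = k) (ho : ∀ i, base.eval s i = o)
    (hv : ∀ i < k, val.eval s i = v i) (hb : ∀ i < k, v i ≤ M.wordBound)
    (hW : count.cost + k * (base.cost + val.cost + 4) + W₂ ≤ W)
    (hD : count.cost + base.cost + val.cost + 4 + D₂ ≤ D)
    (h : ∀ s' : State, s'.ints = Function.update s.ints A
        (fun x => if o ≤ x ∧ x < o + k then v (x - o) else s.ints A x) → s'.nums = s.nums →
      Reaches M d s' W₂ D₂ Q) :
    Reaches M (.seq (.fill A count base val) d) s W D Q :=
  ((reaches_fill A count base val hk ho v hv hb).seq fun s' hs' => h s' hs'.1 hs'.2).mono hW hD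
    fun _ _ h => h

theorem Term.eval_charge (s : State) (b : Term) (i : ℕ) (t : Term) :
    t.eval (s.charge b) i = t.eval s i := by
  induction t <;> simp_all [Term.eval, State.charge]

/-- The index `k` is a strictly decreasing variant, and `Wp k`, `Dp k` are potentials that pay for
all remaining rounds. Geometric and telescoping costs are thus handled round by round. -/
theorem reaches_loop {b : Term} {c : Cmd} {Q : (ℕ → ℕ → ℕ) → (ℕ → ℕ → ℝ) → Prop}
    (Inv : ℕ → (ℕ → ℕ → ℕ) → (ℕ → ℕ → ℝ) → Prop) (Wp Dp : ℕ → ℕ)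
    (hexit : ∀ k (s : State), Inv k s.ints s.nums → b.eval s 0 = 0 →
      b.cost ≤ Wp k ∧ b.cost ≤ Dp k ∧ Q s.ints s.nums)
    (hstep : ∀ k (s : State), Inv k s.ints s.nums → b.eval s 0 ≠ 0 →
      ∃ k' < k, ∃ w d, Reaches M c s w d (Inv k') ∧
        b.cost + w + Wp k' ≤ Wp k ∧ b.cost + d + Dp k' ≤ Dp k)
    {k : ℕ} (h0 : Inv k s.ints s.nums) :
    Reaches M (.loop b c) s (Wp k) (Dp k) Q := by
  induction k using Nat.strong_induction_on generalizing s with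
  | _ k ih =>
    by_cases hb : b.eval s 0 = 0
    · obtain ⟨h1, h2, h3⟩ := hexit k s h0 hb
      exact ⟨_, .loopFalse hb, by simpa [State.charge], by simpa [State.charge], h3⟩
    · obtain ⟨k', hk', w, d, ⟨s', h1, h2, h3, h4⟩, hw, hd⟩ :=
        hstep k (s.charge b) h0 (by rwa [Term.eval_charge])
      obtain ⟨t, t1, t2, t3, t4⟩ := ih k' hk' h4
      simp only [State.charge] at h2 h3
      exact ⟨t, .loopTrue hb h1 t1, by omega, by omega, t4⟩

/-! ### Prefix sums on a complete binary tree -/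

/-- Bottom-up sums in the complete binary tree whose leaves are the cells `2 ^ D, …, 2 ^ (D + 1) - 1`
of array `T`. The register `5` holds `2 ^ D`. -/
def Cmd.scanUp (T : ℕ) : Cmd :=
  .seq (.assign 10 (.reg 5)) <| .loop (.bin .lt (.const 1) (.reg 10)) <|
    .seq (.assign 10 (.reg 10 / .const 2)) <|
      .fill T (.reg 10) (.reg 10)
        (.get T (.const 2 * (.reg 10 + .idx)) + .get T (.const 2 * (.reg 10 + .idx) + .const 1))

/-- Top-down computation of the exclusive prefix sums in array `S`. -/
def Cmd.scanDown (T S : ℕ) : Cmd :=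
  .loop (.bin .lt (.reg 10) (.reg 5)) <|
    .seq (.assign 10 (.const 2 * .reg 10)) <|
      .fill S (.reg 10) (.reg 10)
        (.get S ((.reg 10 + .idx) / .const 2) +
          .ite ((.reg 10 + .idx) % .const 2) (.get T (.reg 10 + .idx - .const 1)) (.const 0))

theorem sum_block_succ (f : ℕ → ℕ) (i h : ℕ) :
    ∑ y ∈ Finset.range (h * 2), f (i * (h * 2) + y) =
      ∑ y ∈ Finset.range h, f (2 * i * h + y) + ∑ y ∈ Finset.range h, f ((2 * i + 1) * h + y) := by
  rw [mul_two, Finset.sum_range_add]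
  congr 1 <;> refine Finset.sum_congr rfl fun y _ => ?_ <;> congr 1 <;> ring

theorem sum_block_le (f : ℕ → ℕ) {i h n : ℕ} (hn : (i + 1) * h ≤ n) :
    ∑ y ∈ Finset.range h, f (i * h + y) ≤ ∑ x ∈ Finset.range n, f x := by
  have h1 : ∑ x ∈ Finset.range (i * h + h), f x ≤ ∑ x ∈ Finset.range n, f x :=
    Finset.sum_le_sum_of_subset (by
      intro x; simp only [Finset.mem_range]; intro hx; linarith)
  rw [Finset.sum_range_add] at h1
  omega

/-- In heap numbering node `2 ^ e + i` covers the `i`-th block of `2 ^ (D - e)` leaves, and its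
children are the nodes `2 * (2 ^ e + i)` and its successor. A level of `2 ^ k` nodes costs `O(2 ^
k)`, so the total is geometric. -/
theorem reaches_scanUp {T D : ℕ} (f : ℕ → ℕ) (hT10 : T ≠ 10)
    (h5 : s.ints 5 0 = 2 ^ D) (hf : ∀ x < 2 ^ D, s.ints T (2 ^ D + x) = f x)
    (hsum : ∑ x ∈ Finset.range (2 ^ D), f x ≤ M.wordBound) (hP : 2 ^ D ≤ M.wordBound) :
    Reaches M (.scanUp T) s (10 + 40 * 2 ^ D) (10 + 50 * D) (fun I X =>
      X = s.nums ∧ (∀ A, A ≠ T → A ≠ 10 → I A = s.ints A) ∧ I 10 0 = 1 ∧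
      (∀ x, 2 ^ D ≤ x → I T x = s.ints T x) ∧
      ∀ e ≤ D, ∀ i < 2 ^ e, I T (2 ^ e + i) =
        ∑ y ∈ Finset.range (2 ^ (D - e)), f (i * 2 ^ (D - e) + y)) := by
  refine reaches_assign_seq (2 ^ D) (4 + 40 * 2 ^ D) (4 + 50 * D) (by simp [h5]) hP
    (by simp; omega) (by simp; omega) fun s₁ hI hX => ?_
  refine reaches_loop (k := D) (Inv := fun k I X => k ≤ D ∧
    X = s.nums ∧ (∀ A, A ≠ T → A ≠ 10 → I A = s.ints A) ∧ I 10 0 = 2 ^ k ∧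
      (∀ x, 2 ^ D ≤ x → I T x = s.ints T x) ∧
      ∀ e ≤ D, k ≤ e → ∀ i < 2 ^ e, I T (2 ^ e + i) =
        ∑ y ∈ Finset.range (2 ^ (D - e)), f (i * 2 ^ (D - e) + y))
    (fun k => 4 + 40 * 2 ^ k) (fun k => 4 + 50 * k) ?_ ?_ ?_
  · rintro k s ⟨hk, hX, hfr, h10, hl, hi⟩ hb
    have hk0 : k = 0 := by
      by_contra hk0
      have : 1 < 2 ^ k := Nat.one_lt_two_pow hk0
      simp [h10] at hb; omega
    subst hk0
    refine ⟨by simp, by simp, hX, hfr, by simpa using h10, hl, fun e he => hi e he (by omega)⟩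
  · rintro k s₂ ⟨hk, hX, hfr, h10, hl, hi⟩ hb
    obtain ⟨k, rfl⟩ : ∃ j, k = j + 1 := by
      refine Nat.exists_eq_succ_of_ne_zero ?_
      rintro rfl
      simp [h10] at hb
    have hk1 : 2 ^ (k + 1) / 2 = 2 ^ k := by rw [pow_succ]; omega
    have hpos : 0 < 2 ^ k := by positivity
    have hkD : 2 ^ (k + 1) ≤ 2 ^ D := Nat.pow_le_pow_right (by simp) hk
    refine ⟨k, by omega, 10 + 23 * 2 ^ k, 40, ?_, ?_, ?_⟩
    · refine reaches_assign_seq (2 ^ k) (2 + 2 ^ k * 23) 25 (by simp [h10, hk1])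
        (by rw [pow_succ] at hkD; omega) (by simp; omega) (by simp) fun s₃ hI hX₃ => ?_
      refine (reaches_fill T _ _ _ (k := 2 ^ k) (o := 2 ^ k) (by simp [hI]) (by simp [hI])
        (fun i => ∑ y ∈ Finset.range (2 ^ (D - k)), f (i * 2 ^ (D - k) + y)) ?_ ?_).mono
        ?_ ?_ ?_
      · intro i hi'
        have e1 : 2 * (2 ^ k + i) = 2 ^ (k + 1) + 2 * i := by rw [pow_succ]; ring
        have e2 : 2 ^ (D - k) = 2 ^ (D - (k + 1)) * 2 := by
          rw [← pow_succ]; congr 1; omega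
        simp only [Term.eval_add, Term.eval_get, Term.eval_mul, Term.eval_const, Term.eval_reg,
          Term.eval_idx, hI, Function.update_self, Function.update_of_ne hT10]
        rw [e1, add_assoc, hi (k + 1) hk le_rfl (2 * i) (by rw [pow_succ]; omega),
          hi (k + 1) hk le_rfl (2 * i + 1) (by rw [pow_succ]; omega), e2, sum_block_succ]
      · intro i hi'
        refine (sum_block_le f (n := 2 ^ D) ?_).trans hsum
        calc (i + 1) * 2 ^ (D - k) ≤ 2 ^ k * 2 ^ (D - k) := Nat.mul_le_mul_right _ hi'
          _ = 2 ^ D := by rw [← pow_add]; congr 1; omega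
      · simp
      · simp
      · rintro I X ⟨hI', hX'⟩
        have hI10 : I 10 = Function.update (s₂.ints 10) 0 (2 ^ k) := by
          simp [hI', hI, hT10.symm]
        refine ⟨by omega, hX'.trans (hX₃.trans hX), fun A h1 h2 => ?_, by simp [hI10], ?_, ?_⟩
        · simp [hI', hI, h1, h2, hfr A h1 h2]
        · intro x hx
          have : ¬ x < 2 ^ k + 2 ^ k := by rw [pow_succ] at hkD; omega
          simp [hI', hI, hT10, this, hl x hx]
        · intro e he hke i hie
          rcases hke.eq_or_lt with rfl | hke
          · simp [hI', hie]
          · have h2 : 2 ^ (k + 1) ≤ 2 ^ e := Nat.pow_le_pow_right (by simp) hke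
            have : ¬ 2 ^ e + i < 2 ^ k + 2 ^ k := by rw [pow_succ] at h2; omega
            simp [hI', hI, hT10, this, hi e he hke i hie]
    · simp only [Term.cost_bin, Term.cost_const, Term.cost_reg, pow_succ]; omega
    · simp; omega
  · refine ⟨le_rfl, hX, fun A h1 h2 => by simp [hI, h2], by simp [hI], fun x hx => by
      simp [hI, hT10], ?_⟩
    intro e he he' i hi
    obtain rfl : e = D := by omega
    simp [hI, hT10, hf i hi]

/-- A left child inherits the prefix sum of its parent, and a right child adds the block sum of its
left sibling. The recursion starts from the zero in the root cell `S 1`. -/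
theorem reaches_scanDown {T S D : ℕ} (f : ℕ → ℕ) (hS5 : S ≠ 5) (hS10 : S ≠ 10)
    (hT10 : T ≠ 10) (hTS : T ≠ S) (h5 : s.ints 5 0 = 2 ^ D) (h10 : s.ints 10 0 = 1)
    (hS : s.ints S 1 = 0)
    (hT : ∀ e ≤ D, ∀ i < 2 ^ e, s.ints T (2 ^ e + i) =
        ∑ y ∈ Finset.range (2 ^ (D - e)), f (i * 2 ^ (D - e) + y))
    (hsum : ∑ x ∈ Finset.range (2 ^ D), f x ≤ M.wordBound) (hP : 2 ^ D ≤ M.wordBound) :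
    Reaches M (.scanDown T S) s (80 * 2 ^ D) (5 + 60 * D) (fun I X =>
      X = s.nums ∧ (∀ A, A ≠ S → A ≠ 10 → I A = s.ints A) ∧
      ∀ i < 2 ^ D, I S (2 ^ D + i) = ∑ x ∈ Finset.range i, f x) := by
  refine Reaches.mono (reaches_loop (k := D) (Inv := fun r I X => r ≤ D ∧
    X = s.nums ∧ (∀ A, A ≠ S → A ≠ 10 → I A = s.ints A) ∧ I 10 0 = 2 ^ (D - r) ∧
      ∀ i < 2 ^ (D - r), I S (2 ^ (D - r) + i) = ∑ x ∈ Finset.range (i * 2 ^ r), f x)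
    -- With `r` levels left, the number of nodes still to be filled is `2 * (2 ^ D - 2 ^ (D - r))`.
    (fun r => 5 + 80 * (2 ^ D - 2 ^ (D - r))) (fun r => 5 + 60 * r) ?_ ?_ ?_) ?_ ?_
    fun I X h => h
  · rintro r s' ⟨hr, hX, hfr, h10', hi⟩ hb
    have hr0 : r = 0 := by
      by_contra hr0
      have : 2 ^ (D - r) < 2 ^ D := Nat.pow_lt_pow_right (by simp) (by omega)
      simp [h10', hfr 5 hS5.symm (by simp), h5] at hb; omega
    subst hr0
    exact ⟨by simp, by simp, hX, hfr, by simpa using hi⟩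
  · rintro r s₂ ⟨hr, hX, hfr, h10', hi⟩ hb
    have h5' : s₂.ints 5 0 = 2 ^ D := by rw [hfr 5 hS5.symm (by simp), h5]
    obtain ⟨r, rfl⟩ : ∃ j, r = j + 1 := by
      refine Nat.exists_eq_succ_of_ne_zero ?_
      rintro rfl
      simp [h10', h5'] at hb
    obtain ⟨k, rfl⟩ : ∃ k, D = k + (r + 1) := ⟨D - (r + 1), by omega⟩
    rw [Nat.add_sub_cancel] at h10' hi
    have hk : k + (r + 1) - r = k + 1 := by omega
    have hkD : 2 ^ (k + 1) ≤ 2 ^ (k + (r + 1)) := Nat.pow_le_pow_right (by simp) (by omega)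
    have hpos : 0 < 2 ^ k := by positivity
    have hk1 : 2 ^ (k + 1) = 2 * 2 ^ k := by rw [pow_succ]; ring
    refine ⟨r, by omega, 10 + 58 * 2 ^ k, 40, ?_, ?_, ?_⟩
    · refine reaches_assign_seq (2 ^ (k + 1)) (2 + 2 ^ (k + 1) * 29) 31 (by simp [h10', hk1])
        (by omega) (by simp; omega) (by simp) fun s₃ hI hX₃ => ?_
      refine (reaches_fill S _ _ _ (k := 2 ^ (k + 1)) (o := 2 ^ (k + 1)) (by simp [hI])
        (by simp [hI]) (fun i => ∑ x ∈ Finset.range (i * 2 ^ r), f x) ?_ ?_).mono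
        ?_ ?_ ?_
      · intro i hi'
        have hT' := hT (k + 1) (by omega)
        have e0 : k + (r + 1) - (k + 1) = r := by omega
        rw [e0] at hT'
        have e1 : (2 * 2 ^ k + i) / 2 = 2 ^ k + i / 2 := by omega
        simp only [Term.eval_add, Term.eval_sub, Term.eval_get, Term.eval_div, Term.eval_mod,
          Term.eval_ite, Term.eval_const, Term.eval_reg,
          Term.eval_idx, hI, Function.update_self, Function.update_of_ne hS10,
          Function.update_of_ne hT10, hfr T hTS hT10]
        rw [hk1, e1, hi _ (by omega)]
        rcases Nat.even_or_odd' i with ⟨c, rfl | rfl⟩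
        · have : (2 * 2 ^ k + 2 * c) % 2 = 0 := by omega
          rw [if_pos this]
          simp only [Nat.mul_div_cancel_left c two_pos]
          rw [pow_succ, add_zero]; congr 2; ring
        · have : (2 * 2 ^ k + (2 * c + 1)) % 2 ≠ 0 := by omega
          rw [if_neg this, show 2 * 2 ^ k + (2 * c + 1) - 1 = 2 ^ (k + 1) + 2 * c by omega,
            hT' _ (by omega), show (2 * c + 1) / 2 = c by omega,
            show c * 2 ^ (r + 1) = 2 * c * 2 ^ r by ring, ← Finset.sum_range_add]
          congr 2; ring
      · intro i hi'
        refine le_trans (Finset.sum_le_sum_of_subset ?_) hsum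
        intro x
        simp only [Finset.mem_range]
        intro hx
        refine hx.trans_le ?_
        calc i * 2 ^ r ≤ 2 ^ (k + 1) * 2 ^ r := Nat.mul_le_mul_right _ hi'.le
          _ = 2 ^ (k + (r + 1)) := by rw [← pow_add]; congr 1; omega
      · simp
      · simp
      · rintro I X ⟨hI', hX'⟩
        have hI10 : I 10 = Function.update (s₂.ints 10) 0 (2 ^ (k + 1)) := by
          simp [hI', hI, hS10.symm]
        refine ⟨by omega, hX'.trans (hX₃.trans hX), fun A h1 h2 => ?_, by simp [hI10, hk], ?_⟩
        · simp [hI', hI, h1, h2, hfr A h1 h2]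
        · intro i hi'
          rw [hk] at hi' ⊢
          simp [hI', hi']
    · simp only [Term.cost_bin, Term.cost_reg, Nat.add_sub_cancel, hk]; omega
    · simp; omega
  · refine ⟨le_rfl, rfl, fun A h1 h2 => rfl, by simp [h10], ?_⟩
    intro i hi
    simp at hi
    simp [hi, hS]
  · simp
    have : 0 < 2 ^ D := by positivity
    omega
  · rfl

/-- Exclusive prefix sums of the leaves of the tree `T`, at the leaves of the tree `S`. -/
def Cmd.scan (T S : ℕ) : Cmd := .seq (.scanUp T) (.scanDown T S)

theorem reaches_scan {T S D : ℕ} (f : ℕ → ℕ) (hS5 : S ≠ 5) (hS10 : S ≠ 10) (hT5 : T ≠ 5)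
    (hT10 : T ≠ 10) (hTS : T ≠ S) (h5 : s.ints 5 0 = 2 ^ D)
    (hS : s.ints S 1 = 0) (hf : ∀ x < 2 ^ D, s.ints T (2 ^ D + x) = f x)
    (hsum : ∑ x ∈ Finset.range (2 ^ D), f x ≤ M.wordBound) (hP : 2 ^ D ≤ M.wordBound) :
    Reaches M (.scan T S) s (10 + 120 * 2 ^ D) (15 + 110 * D) (fun I X =>
      X = s.nums ∧ (∀ A, A ≠ T → A ≠ S → A ≠ 10 → I A = s.ints A) ∧
      (∀ x, 2 ^ D ≤ x → I T x = s.ints T x) ∧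
      ∀ i < 2 ^ D, I S (2 ^ D + i) = ∑ x ∈ Finset.range i, f x) := by
  refine Reaches.mono (Reaches.seq (reaches_scanUp f hT10 h5 hf hsum hP) (W₂ := 80 * 2 ^ D)
    (D₂ := 5 + 60 * D) ?_) (by omega) (by omega) fun I X h => h
  rintro s₁ ⟨hX, hfr, h10, hl, hi⟩
  refine (reaches_scanDown f hS5 hS10 hT10 hTS (by rw [hfr 5 hT5.symm (by simp), h5]) h10
    (by rw [hfr S hTS.symm hS10, hS]) hi hsum hP).mono le_rfl le_rfl ?_
  rintro I X ⟨hX', hfr', hi'⟩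
  refine ⟨hX'.trans hX, fun A h1 h2 h3 => ?_, fun x hx => ?_, hi'⟩
  · rw [hfr' A h2 h3, hfr A h1 h3]
  · rw [hfr' T hTS hT10, hl x hx]

/-! ### The power of two and the table of valuations -/

/-- Computes `N = n + 2 m` (register `4`), a power `2 ^ D ≥ 4 N` (register `5`), `D` (register `6`) and
a table of `2`-adic valuations (array `7`). -/
def Cmd.init : Cmd :=
  .seq (.assign 4 (.reg 0 + .get 1 (.reg 0))) <| .seq (.assign 5 (.const 1)) <|
    .loop (.bin .lt (.reg 5) (.const 4 * .reg 4)) <|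
      .seq (.fill 7 (.reg 5) (.reg 5)
        (.ite ((.reg 5 + .idx) % .const 2) (.const 0)
          (.get 7 ((.reg 5 + .idx) / .const 2) + .const 1))) <|
      .seq (.assign 6 (.reg 6 + .const 1)) (.assign 5 (.reg 5 + .reg 5))

/-- This recursion lets the table double in one parallel step: entries in `[2 ^ k, 2 ^ (k + 1))`
refer only to smaller ones. -/
theorem padicValNat_two_rec {x : ℕ} (hx : x ≠ 0) :
    padicValNat 2 x = if x % 2 = 0 then padicValNat 2 (x / 2) + 1 else 0 := by
  split_ifs with h
  · have h2 : 2 ∣ x := Nat.dvd_of_mod_eq_zero h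
    have := one_le_padicValNat_of_dvd hx h2
    rw [padicValNat.div h2]; omega
  · exact padicValNat.eq_zero_of_not_dvd fun h2 => h (Nat.mod_eq_zero_of_dvd h2)

theorem padicValNat_two_le (x : ℕ) : padicValNat 2 x ≤ x := by
  rcases eq_or_ne x 0 with rfl | hx
  · simp
  · exact (Nat.lt_two_pow_self.trans_le (Nat.le_of_dvd (by omega) pow_padicValNat_dvd)).le

theorem padicValNat_two_lt {x D : ℕ} (hD : 0 < D) (hx : x < 2 ^ D) : padicValNat 2 x < D := by
  rcases eq_or_ne x 0 with rfl | hx0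
  · simpa
  · exact (Nat.pow_lt_pow_iff_right (by simp)).1
      ((Nat.le_of_dvd (by omega) (pow_padicValNat_dvd (p := 2))).trans_lt hx)

/-- The factor `4` leaves room in the tree for the counters of the sort. The upper bound keeps `2 ^
D` linear in `N` and makes `D` the exponent at which the doubling loop of `Cmd.init` stops. -/
theorem exists_two_pow {N : ℕ} (hN : 0 < N) : ∃ D, 0 < D ∧ 4 * N ≤ 2 ^ D ∧ 2 ^ D < 8 * N := by
  refine ⟨Nat.clog 2 (4 * N), Nat.clog_pos (by simp) (by omega), Nat.le_pow_clog (by simp) _, ?_⟩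
  have h := Nat.pow_pred_clog_lt_self (b := 2) (by simp) (x := 4 * N) (by omega)
  have h0 : 0 < Nat.clog 2 (4 * N) := Nat.clog_pos (by simp) (by omega)
  obtain ⟨k, hk⟩ := Nat.exists_eq_succ_of_ne_zero h0.ne'
  rw [hk] at h ⊢
  simp only [Nat.pred_succ] at h
  rw [pow_succ]; omega

theorem reaches_init {n N D : ℕ} (h0 : s.ints 0 0 = n) (hN : n + s.ints 1 n = N)
    (h4D : 4 * N ≤ 2 ^ D) (hD8 : 2 ^ D < 8 * N)
    (h6 : s.ints 6 0 = 0) (h7 : s.ints 7 0 = 0) (hP : 8 * N ≤ M.wordBound) :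
    Reaches M .init s (30 + 60 * 2 ^ D) (30 + 70 * D) (fun I X =>
      X = s.nums ∧ (∀ A, A ∉ [4, 5, 6, 7] → I A = s.ints A) ∧ I 4 0 = N ∧ I 5 0 = 2 ^ D ∧
      I 6 0 = D ∧ ∀ x < 2 ^ D, I 7 x = padicValNat 2 x) := by
  refine reaches_assign_seq N (15 + 60 * 2 ^ D) (15 + 70 * D) (by simp [h0, hN]) (by omega)
    (by simp; omega) (by simp; omega) fun s₁ hI₁ hX₁ => ?_
  refine reaches_assign_seq 1 (7 + 60 * (2 ^ D - 2 ^ 0)) (7 + 70 * D) (by simp) (by omega)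
    (by simp; omega) (by simp; omega) fun s₂ hI₂ hX₂ => ?_
  refine Reaches.mono (reaches_loop (k := D) (Inv := fun r I X => r ≤ D ∧
    X = s.nums ∧ (∀ A, A ∉ [4, 5, 6, 7] → I A = s.ints A) ∧ I 4 0 = N ∧ I 5 0 = 2 ^ (D - r) ∧
      I 6 0 = D - r ∧ ∀ x < 2 ^ (D - r), I 7 x = padicValNat 2 x)
    (fun r => 7 + 60 * (2 ^ D - 2 ^ (D - r))) (fun r => 7 + 70 * r) ?_ ?_ ?_) (by simp) le_rfl fun I X h => h
  · rintro r s' ⟨hr, hX, hfr, h4', h5', h6', h7'⟩ hb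
    have hr0 : r = 0 := by
      by_contra hr0
      simp [h4', h5'] at hb
      obtain ⟨e, rfl⟩ : ∃ e, D = e + 1 := ⟨D - 1, by omega⟩
      have : 2 ^ (e + 1 - r) ≤ 2 ^ e := Nat.pow_le_pow_right (by simp) (by omega)
      rw [pow_succ] at hD8
      omega
    subst hr0
    exact ⟨by simp, by simp, hX, hfr, h4', h5', h6', h7'⟩
  · rintro r s₃ ⟨hr, hX, hfr, h4', h5', h6', h7'⟩ hb
    obtain ⟨r, rfl⟩ : ∃ j, r = j + 1 := by
      refine Nat.exists_eq_succ_of_ne_zero ?_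
      rintro rfl
      simp [h4', h5'] at hb
      omega
    obtain ⟨k, rfl⟩ : ∃ k, D = k + (r + 1) := ⟨D - (r + 1), by omega⟩
    rw [Nat.add_sub_cancel] at h5' h6' h7'
    have hk : k + (r + 1) - r = k + 1 := by omega
    have hkD : 2 ^ (k + 1) ≤ 2 ^ (k + (r + 1)) := Nat.pow_le_pow_right (by simp) (by omega)
    have hpos : 0 < 2 ^ k := by positivity
    have hk1 : 2 ^ (k + 1) = 2 * 2 ^ k := by rw [pow_succ]; ring
    have hkk : k < 2 ^ k := Nat.lt_two_pow_self
    refine ⟨r, by omega, 19 + 23 * 2 ^ k, 50, ?_, ?_, ?_⟩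
    · refine reaches_fill_seq (fun i => padicValNat 2 (2 ^ k + i)) (2 ^ k) (2 ^ k) 17 17
        (by simp [h5']) (by simp [h5']) ?_ ?_ (by simp; omega) (by simp) fun s₄ hI₄ hX₄ => ?_
      · intro i hi
        rw [padicValNat_two_rec (x := 2 ^ k + i) (by omega)]
        simp only [Term.eval_add, Term.eval_get, Term.eval_div, Term.eval_mod,
          Term.eval_ite, Term.eval_const, Term.eval_reg, Term.eval_idx, h5']
        rw [h7' _ (by omega)]
      · intro i hi
        refine (padicValNat_two_le _).trans ?_
        omega
      refine reaches_assign_seq (k + 1) 9 9 (by simp [hI₄, h6']) (by omega) (by simp)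
        (by simp) fun s₅ hI₅ hX₅ => ?_
      refine (reaches_assign 5 _ (v := 2 ^ (k + 1)) (by simp [hI₅, hI₄, h5', hk1, two_mul])
        (by omega)).mono (by simp) (by simp) ?_
      rintro I X ⟨rfl, rfl⟩
      rw [hk]
      refine ⟨by omega, by rw [hX₅, hX₄, hX], fun A hA => ?_, ?_, ?_, ?_, fun x hx => ?_⟩
      · have hA' := hA
        simp only [List.mem_cons, List.not_mem_nil, or_false, not_or] at hA'
        simp [hI₅, hI₄, hA', hfr A hA]
      · simp [hI₅, hI₄, h4']
      · simp
      · simp [hI₅]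
      · simp only [hI₅, hI₄]
        simp only [Nat.reduceEqDiff, Function.update, dite_eq_ite, if_true, if_false, eq_rec_constant]
        split_ifs with h
        · congr 1; omega
        · exact h7' x (by omega)
    · simp only [Term.cost_bin, Term.cost_mul, Term.cost_const, Term.cost_reg, Nat.add_sub_cancel,
        hk]
      omega
    · simp; omega
  · refine ⟨le_rfl, by rw [hX₂, hX₁], fun A hA => ?_, ?_, ?_, ?_, fun x hx => ?_⟩
    · simp only [List.mem_cons, List.not_mem_nil, or_false, not_or] at hA
      simp [hI₂, hI₁, hA]
    · simp [hI₂, hI₁]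
    · simp [hI₂]
    · simp [hI₂, hI₁, h6]
    · obtain rfl : x = 0 := by simpa using hx
      simp [hI₂, hI₁, h7]

/-! ### Positions for concatenated adjacency lists -/

/-- Concatenated lists over `{0, …, n - 1}`: list `u` occupies the cells `st u, …, st (u + 1) - 1` of
`tgt`, and `L` is the total length. -/
structure IsLayout (n L : ℕ) (st tgt : ℕ → ℕ) : Prop where
  zero : st 0 = 0
  last : st n = L
  step : ∀ u < n, st u ≤ st (u + 1)
  lt : ∀ x < L, tgt x < n

namespace IsLayout
variable {n L : ℕ} {st tgt : ℕ → ℕ}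

theorem mono (h : IsLayout n L st tgt) {u v : ℕ} (huv : u ≤ v) (hv : v ≤ n) : st u ≤ st v := by
  induction v, huv using Nat.le_induction with
  | base => rfl
  | succ v _ ih => exact (ih (by omega)).trans (h.step v (by omega))

/-- Each list gets one extra position, its head `st u + u`, in front of its entries. This keeps the
heads distinct even for empty lists, and gives `L + n` positions in all. -/
theorem sum_range {β : Type*} [AddCommMonoid β] (h : IsLayout n L st tgt) (F : ℕ → β) {k : ℕ}
    (hk : k ≤ n) :
    ∑ q ∈ Finset.range (st k + k), F q =
      ∑ u ∈ Finset.range k, (F (st u + u) +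
        ∑ i ∈ Finset.range (st (u + 1) - st u), F (st u + u + 1 + i)) := by
  induction k with
  | zero => simp [h.zero]
  | succ k ih =>
    have := h.step k (by omega)
    rw [Finset.sum_range_succ, ← ih (by omega),
      show st (k + 1) + (k + 1) = st k + k + 1 + (st (k + 1) - st k) by omega,
      Finset.sum_range_add, Finset.sum_range_succ, add_assoc]

theorem exists_eq (h : IsLayout n L st tgt) {k : ℕ} (hk : k ≤ n) {q : ℕ} (hq : q < st k + k) :
    ∃ u < k, q = st u + u ∨ ∃ i < st (u + 1) - st u, q = st u + u + 1 + i := by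
  induction k with
  | zero => simp [h.zero] at hq
  | succ k ih =>
    have := h.step k (by omega)
    by_cases hq' : q < st k + k
    · obtain ⟨u, hu, h'⟩ := ih (by omega) hq'
      exact ⟨u, by omega, h'⟩
    · refine ⟨k, by omega, ?_⟩
      by_cases hq'' : q = st k + k
      · exact .inl hq''
      · exact .inr ⟨q - (st k + k + 1), by omega, by omega⟩

open Classical in
/-- The indicator of the positions that head a list. -/
noncomputable def head (n : ℕ) (st : ℕ → ℕ) (x : ℕ) : ℕ := if ∃ v < n, st v + v = x then 1 else 0

theorem head_self {u : ℕ} (hu : u < n) : head n st (st u + u) = 1 := if_pos ⟨u, hu, rfl⟩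

/-- The heads `st v + v` increase strictly with `v`, so none falls among the entries of list `u`. -/
theorem head_slot (h : IsLayout n L st tgt) {u i : ℕ} (hu : u < n) (hi : i < st (u + 1) - st u) :
    head n st (st u + u + 1 + i) = 0 := by
  refine if_neg ?_
  rintro ⟨v, hv, hvu⟩
  rcases le_or_gt v u with h1 | h1
  · have := h.mono h1 hu.le
    omega
  · have := h.mono (show u + 1 ≤ v from h1) hv.le
    omega

theorem sum_head (h : IsLayout n L st tgt) {u : ℕ} (hu : u ≤ n) :
    ∑ x ∈ Finset.range (st u + u), head n st x = u := by
  rw [h.sum_range _ hu, Finset.sum_congr rfl (g := fun _ => 1)]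
  · simp
  · intro v hv
    have hv := (Finset.mem_range.1 hv).trans_le hu
    rw [head_self hv, Finset.sum_eq_zero fun i hi => h.head_slot hv (Finset.mem_range.1 hi),
      add_zero]

/-- Counting heads recovers the owner of an entry: the count minus one is `u`, and the position
minus the count is the address `st u + i` in the input. -/
theorem sum_head_slot (h : IsLayout n L st tgt) {u i : ℕ} (hu : u < n)
    (hi : i ≤ st (u + 1) - st u) :
    ∑ x ∈ Finset.range (st u + u + 1 + i), head n st x = u + 1 := by
  rw [Finset.sum_range_add, Finset.sum_range_succ, h.sum_head hu.le, head_self hu,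
    Finset.sum_eq_zero fun j hj => h.head_slot hu ((Finset.mem_range.1 hj).trans_le hi),
    add_zero]

end IsLayout

/-- Whether the current position heads a list, after the scan of arrays `8`, `9`. -/
def Term.isHead : Term := .get 8 (.reg 5 + .idx)

/-- The number of list heads before the current position. -/
def Term.headCount : Term := .get 9 (.reg 5 + .idx)

/-- Lists, for all positions, the vertex (array `11`), its neighbour (array `12`), the address of
the weight (array `13`) and the key (array `14`). -/
def Cmd.items : Cmd :=
  .seq (.intStep 8 (.reg 0) (.const 1) (.reg 5 + (.get 1 .idx + .idx)) (.const 1)) <|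
  .seq (.scan 8 9) <|
  .seq (.fill 13 (.reg 4) (.const 0) (.ite .isHead (.get 1 (.reg 0)) (.idx - .headCount))) <|
  .seq (.fill 11 (.reg 4) (.const 0) (.ite .isHead (.const 0) (.headCount - .const 1))) <|
  .seq (.fill 12 (.reg 4) (.const 0) (.ite .isHead (.const 0) (.get 2 (.idx - .headCount)))) <|
  .fill 14 (.reg 4) (.const 0)
    (.get 7 ((.get 11 .idx - .get 12 .idx) + (.get 12 .idx - .get 11 .idx)))

theorem reaches_items {n L N D : ℕ} (hL : IsLayout n L (s.ints 1) (s.ints 2))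
    (h0 : s.ints 0 0 = n) (hN : L + n = N) (hND : 4 * N ≤ 2 ^ D) (hn : 0 < n) (h4 : s.ints 4 0 = N)
    (h5 : s.ints 5 0 = 2 ^ D) (h7 : ∀ x < 2 ^ D, s.ints 7 x = padicValNat 2 x)
    (h8 : ∀ x, s.ints 8 x = 0) (h9 : s.ints 9 1 = 0) (hP : 2 ^ D ≤ M.wordBound) :
    Reaches M .items s (30 + 150 * 2 ^ D) (130 + 110 * D) (fun I X =>
      X = s.nums ∧ (∀ A, A ∉ [8, 9, 10, 11, 12, 13, 14] → I A = s.ints A) ∧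
      (∀ u < n, I 13 (s.ints 1 u + u) = L ∧ ∀ i < s.ints 1 (u + 1) - s.ints 1 u,
        I 11 (s.ints 1 u + u + 1 + i) = u ∧
        I 12 (s.ints 1 u + u + 1 + i) = s.ints 2 (s.ints 1 u + i) ∧
        I 13 (s.ints 1 u + u + 1 + i) = s.ints 1 u + i) ∧
      ∀ q < N, I 11 q < n ∧ I 12 q < n ∧
        I 14 q = padicValNat 2 ((I 11 q - I 12 q) + (I 12 q - I 11 q))) := by
  set st := s.ints 1 with hst
  set tgt := s.ints 2 with htgt
  set f := IsLayout.head n st with hf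
  have hf1 : ∀ x, f x ≤ 1 := fun x => by
    simp only [hf, IsLayout.head]; split_ifs <;> simp
  have hnN : n ≤ N := by omega
  refine Reaches.mono (Reaches.seq (W₂ := 25 + 120 * 2 ^ D + 80 * N) (D₂ := 110 + 110 * D)
    (reaches_intStep 8 _ _ _ _ (k := n) (by simp [h0])
      (fun x => if 2 ^ D ≤ x then f (x - 2 ^ D) else 0) ?_ ?_) ?_) ?_ ?_ fun I X h => h
  · intro i hi _
    simp only [Term.eval_add, Term.eval_reg, Term.eval_get, Term.eval_idx, Term.eval_const, h5]
    rw [if_pos (by omega), Nat.add_sub_cancel_left]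
    exact ⟨(IsLayout.head_self hi).symm, by omega⟩
  · intro x hx
    rw [h8]
    split_ifs with h
    · refine if_neg ?_
      rintro ⟨v, hv, hvx⟩
      refine hx v hv (by simp) ?_
      simp only [Term.eval_add, Term.eval_reg, Term.eval_get, Term.eval_idx, h5]
      rw [← hst]; omega
    · rfl
  · rintro s₁ ⟨hI₁, hX₁⟩
    refine Reaches.mono (Reaches.seq (W₂ := 10 + 80 * N) (D₂ := 95)
      (reaches_scan (T := 8) (S := 9) f (by simp) (by simp) (by simp) (by simp) (by simp)
      (by simp [hI₁, h5]) (by simp [hI₁, h9]) (D := D) (by simp [hI₁]) ?_ hP) ?_) ?_ ?_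
      fun I X h => h
    · refine (Finset.sum_le_sum fun x _ => hf1 x).trans ?_
      simpa using hP
    · rintro s₂ ⟨hX₂, hfr₂, hT₂, hS₂⟩
      have hh : ∀ i < N, s₂.ints 8 (2 ^ D + i) = f i := fun i hi => by
        rw [hT₂ _ (by omega), hI₁]; simp
      have hc : ∀ i < N, s₂.ints 9 (2 ^ D + i) = ∑ x ∈ Finset.range i, f x :=
        fun i hi => hS₂ i (by omega)
      have hs : ∀ A, A ≠ 8 → A ≠ 9 → A ≠ 10 → s₂.ints A = s.ints A := fun A h8 h9 h10 => by
        rw [hfr₂ A h8 h9 h10, hI₁, Function.update_of_ne h8]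
      have hcle : ∀ i, ∑ x ∈ Finset.range i, f x ≤ i := fun i =>
        (Finset.sum_le_sum fun x _ => hf1 x).trans (by simp)
      have hlast : ∀ q < N, f q = 0 → q - ∑ x ∈ Finset.range q, f x < L ∧
          ∑ x ∈ Finset.range q, f x - 1 < n := by
        intro q hq hfq
        obtain ⟨u, hu, rfl | ⟨i, hi, rfl⟩⟩ :=
          hL.exists_eq le_rfl (q := q) (by rw [hL.last, hN]; exact hq)
        · simp [hf, IsLayout.head_self hu] at hfq
        · rw [hf, hL.sum_head_slot hu hi.le]
          have := hL.mono (show u + 1 ≤ n from hu) le_rfl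
          rw [hL.last] at this
          omega
      -- A head receives the address `L` just past the lists, where the input weight is zero, so it
      -- will not count in any weighted sum.
      refine reaches_fill_seq (fun q => if f q = 0 then q - ∑ x ∈ Finset.range q, f x else L)
        N 0 (8 + 59 * N) 71 (by simp [hs, h4]) (by simp) ?_ ?_
        (by simp [Term.isHead, Term.headCount]; omega) (by simp [Term.isHead, Term.headCount])
        fun s₃ hI₃ hX₃ => ?_
      · intro i hi
        simp [Term.isHead, Term.headCount, hs, h5, hh i hi, hc i hi, h0, ← hst, hL.last]
      · intro i hi
        split_ifs <;> omega
      refine reaches_fill_seq (fun q => if f q = 0 then (∑ x ∈ Finset.range q, f x) - 1 else 0)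
        N 0 (6 + 40 * N) 50 (by simp [hI₃, hs, h4]) (by simp) ?_ ?_
        (by simp [Term.isHead, Term.headCount]; omega) (by simp [Term.isHead, Term.headCount])
        fun s₄ hI₄ hX₄ => ?_
      · intro i hi
        simp [Term.isHead, Term.headCount, hI₃, hs, h5, hh i hi, hc i hi]
      · intro i hi
        have := hcle i
        split_ifs <;> omega
      refine reaches_fill_seq
        (fun q => if f q = 0 then tgt (q - ∑ x ∈ Finset.range q, f x) else 0)
        N 0 (4 + 20 * N) 25 (by simp [hI₄, hI₃, hs, h4]) (by simp) ?_ ?_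
        (by simp [Term.isHead, Term.headCount]; omega) (by simp [Term.isHead, Term.headCount])
        fun s₅ hI₅ hX₅ => ?_
      · intro i hi
        simp [Term.isHead, Term.headCount, hI₄, hI₃, hs, h5, hh i hi, hc i hi, htgt]
      · intro i hi
        split_ifs with hfi
        · have := hL.lt _ (hlast i hi hfi).1
          omega
        · omega
      have hU : ∀ q < N, s₅.ints 11 q = if f q = 0 then (∑ x ∈ Finset.range q, f x) - 1 else 0 :=
        fun q hq => by simp [hI₅, hI₄, hq]
      have hV : ∀ q < N, s₅.ints 12 q =
          if f q = 0 then tgt (q - ∑ x ∈ Finset.range q, f x) else 0 :=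
        fun q hq => by simp [hI₅, hq]
      have hSL : ∀ q < N, s₅.ints 13 q =
          if f q = 0 then q - ∑ x ∈ Finset.range q, f x else L :=
        fun q hq => by simp [hI₅, hI₄, hI₃, hq]
      have hUn : ∀ q < N, s₅.ints 11 q < n := fun q hq => by
        rw [hU q hq]; split_ifs with hfq
        exacts [(hlast q hq hfq).2, hn]
      have hVn : ∀ q < N, s₅.ints 12 q < n := fun q hq => by
        rw [hV q hq]; split_ifs with hfq
        exacts [hL.lt _ (hlast q hq hfq).1, hn]
      -- The two truncated differences add up to the distance of the ends. At a head both ends are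
      -- `0`, and the key is the default `padicValNat 2 0 = 0`.
      refine (reaches_fill 14 _ _ _ (k := N) (o := 0) (by simp [hI₅, hI₄, hI₃, hs, h4]) (by simp)
        (fun q => padicValNat 2
          ((s₅.ints 11 q - s₅.ints 12 q) + (s₅.ints 12 q - s₅.ints 11 q))) ?_ ?_).mono ?_ ?_ ?_
      · intro i hi
        have h7' : s₅.ints 7 = s.ints 7 := by simp [hI₅, hI₄, hI₃, hs]
        have := hUn i hi
        have := hVn i hi
        simp only [Term.eval_add, Term.eval_sub, Term.eval_get, Term.eval_idx, h7']
        exact h7 _ (by omega)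
      · intro i hi
        have := hUn i hi
        have := hVn i hi
        refine (padicValNat_two_le _).trans ?_
        omega
      · simp; omega
      · simp
      · rintro I X ⟨rfl, rfl⟩
        refine ⟨by rw [hX₅, hX₄, hX₃, hX₂, hX₁], fun A hA => ?_, ?_, ?_⟩
        · simp only [List.mem_cons, List.not_mem_nil, or_false, not_or] at hA
          simp [hI₅, hI₄, hI₃, hA, hs]
        · intro u hu
          have h1 := hL.mono (show u + 1 ≤ n from hu) le_rfl
          have h2 := hL.step u hu
          rw [hL.last] at h1
          simp only [Function.update_of_ne (show (11 : ℕ) ≠ 14 by simp),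
            Function.update_of_ne (show (12 : ℕ) ≠ 14 by simp),
            Function.update_of_ne (show (13 : ℕ) ≠ 14 by simp)]
          refine ⟨?_, fun i hi => ?_⟩
          · rw [hSL _ (by omega), hf, IsLayout.head_self hu, if_neg (by simp)]
          · rw [hSL _ (by omega), hU _ (by omega), hV _ (by omega), hf, hL.head_slot hu hi,
              hL.sum_head_slot hu hi.le, if_pos rfl, if_pos rfl, if_pos rfl]
            have : st u + u + 1 + i - (u + 1) = st u + i := by omega
            simp [this]
        · intro q hq
          have := hUn q hq
          have := hVn q hq
          simp_all
    · omega
    · omega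
  · simp; omega
  · simp; omega

/-! ### Ranks and groups of equal key -/

section rank

variable {N : ℕ} {F key : ℕ → ℕ}

/-- The number of elements below `q` in the order given by `F`. -/
def rank (N : ℕ) (F : ℕ → ℕ) (q : ℕ) : ℕ := ((Finset.range N).filter fun q' => F q' < F q).card

/-- The number of elements with key less than `k`. -/
def countBelow (N : ℕ) (key : ℕ → ℕ) (k : ℕ) : ℕ :=
  ((Finset.range N).filter fun q => key q < k).card

theorem countBelow_mono {j k : ℕ} (h : j ≤ k) : countBelow N key j ≤ countBelow N key k :=
  Finset.card_le_card (Finset.monotone_filter_right _ fun _ _ hq => lt_of_lt_of_le hq h)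

theorem countBelow_le (k : ℕ) : countBelow N key k ≤ N := by
  simpa [countBelow] using Finset.card_filter_le (Finset.range N) (fun q => key q < k)

theorem rank_lt_rank {q q' : ℕ} (hq : q < N) (h : F q < F q') : rank N F q < rank N F q' := by
  refine Finset.card_lt_card ⟨fun x hx => ?_, fun hsub => ?_⟩
  · simp only [Finset.mem_filter] at hx ⊢
    exact ⟨hx.1, hx.2.trans h⟩
  · have := hsub (x := q) (by simp [hq, h])
    simp at this

theorem rank_injOn (hF : Set.InjOn F (Finset.range N)) :
    Set.InjOn (rank N F) (Finset.range N) := by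
  intro q hq q' hq' h
  simp only [Finset.coe_range, Set.mem_Iio] at hq hq'
  rcases lt_trichotomy (F q) (F q') with h1 | h1 | h1
  · exact absurd h (rank_lt_rank hq h1).ne
  · exact hF (by simpa) (by simpa) h1
  · exact absurd h (rank_lt_rank hq' h1).ne'

/-- As `F` refines the order of the keys, the ranks of group `j` lie in the interval between two
consecutive values of `countBelow`, and they fill it because the cardinalities agree. A sum over a
group thus becomes a sum over consecutive cells of the sorted array. -/
theorem sum_rank_group (hF : Set.InjOn F (Finset.range N))
    (hmono : ∀ q < N, ∀ q' < N, key q < key q' → F q < F q') (perm : ℕ → ℕ)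
    (hperm : ∀ q < N, perm (rank N F q) = q) (j : ℕ) (g : ℕ → ℝ) :
    ∑ i ∈ Finset.range (countBelow N key (j + 1) - countBelow N key j),
      g (perm (countBelow N key j + i)) = ∑ q ∈ (Finset.range N).filter (fun q => key q = j), g q := by
  have himg : ((Finset.range N).filter (fun q => key q = j)).image (rank N F) =
      Finset.Ico (countBelow N key j) (countBelow N key (j + 1)) := by
    apply Finset.eq_of_subset_of_card_le
    · intro x hx
      obtain ⟨q, hq, rfl⟩ := Finset.mem_image.1 hx
      simp only [Finset.mem_filter, Finset.mem_range] at hq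
      rw [Finset.mem_Ico]
      constructor
      · refine Finset.card_le_card fun y hy => ?_
        simp only [Finset.mem_filter, Finset.mem_range] at hy ⊢
        exact ⟨hy.1, hmono _ hy.1 _ hq.1 (by omega)⟩
      · refine Finset.card_lt_card ⟨fun y hy => ?_, fun hsub => ?_⟩
        · simp only [Finset.mem_filter, Finset.mem_range] at hy ⊢
          refine ⟨hy.1, ?_⟩
          by_contra hlt
          exact absurd (hmono q hq.1 y hy.1 (by omega)) (by omega)
        · have := hsub (x := q) (by simp [hq])
          simp at this
    · rw [Finset.card_image_of_injOn ((rank_injOn hF).mono (Finset.coe_subset.2 (Finset.filter_subset _ _))), Nat.card_Ico, countBelow,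
        countBelow, ← Finset.card_sdiff_of_subset]
      · refine Finset.card_le_card fun y hy => ?_
        simp only [Finset.mem_sdiff, Finset.mem_filter, Finset.mem_range] at hy ⊢
        exact ⟨hy.1.1, by omega⟩
      · exact Finset.monotone_filter_right _ fun _ _ h => Nat.lt_succ_of_lt h
  rw [← Finset.sum_Ico_eq_sum_range (fun x => g (perm x)), ← himg,
    Finset.sum_image ((rank_injOn hF).mono (Finset.coe_subset.2 (Finset.filter_subset _ _)))]
  refine Finset.sum_congr rfl fun q hq => ?_
  rw [hperm q (by simpa using (Finset.mem_filter.1 hq).1)]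

end rank

/-! ### Counters per key and block -/

section count

/-- The counter of position `q`: its key and its block of length `D`. -/
def code (D B : ℕ) (key : ℕ → ℕ) (q : ℕ) : ℕ := key q * B + q / D

/-- The number of positions with counter `i` among the first `t` ones of each block. -/
def counter (N D B : ℕ) (key : ℕ → ℕ) (t i : ℕ) : ℕ :=
  ((Finset.range N).filter fun q => q % D < t ∧ code D B key q = i).card

variable {N D B : ℕ} {key : ℕ → ℕ}

/-- The block index is the counter modulo `B`, and block and offset determine the position. In one
round of the counting loop all processors work at the same offset, so they update different counters
and no increment is lost. -/
theorem code_inj {q q' : ℕ} (hq : q / D < B) (hq' : q' / D < B) (hmod : q % D = q' % D)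
    (h : code D B key q = code D B key q') : q = q' := by
  have h1 : code D B key q % B = q / D := by
    rw [code, Nat.mul_add_mod_of_lt hq]
  have h2 : code D B key q' % B = q' / D := by
    rw [code, Nat.mul_add_mod_of_lt hq']
  rw [← Nat.div_add_mod q D, ← Nat.div_add_mod q' D, hmod, ← h1, ← h2, h]

theorem div_lt_blocks {q : ℕ} (hq : q < N) : q / D < N / D + 1 :=
  Nat.lt_succ_of_le (Nat.div_le_div_right hq.le)

theorem counter_le (t i : ℕ) : counter N D B key t i ≤ N := by
  simpa [counter] using Finset.card_filter_le (Finset.range N) (fun q => q % D < t ∧ code D B key q = i)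

theorem counter_succ (hB : ∀ q < N, q / D < B) {q : ℕ} (hq : q < N) :
    counter N D B key (q % D + 1) (code D B key q) =
      counter N D B key (q % D) (code D B key q) + 1 := by
  rw [counter, counter, ← Finset.card_insert_of_notMem (a := q) (by simp)]
  congr 1
  ext x
  simp only [Finset.mem_filter, Finset.mem_range, Finset.mem_insert]
  constructor
  · rintro ⟨h1, h2, h3⟩
    rcases (Nat.lt_succ_iff_lt_or_eq.1 h2) with h2 | h2
    · exact .inr ⟨h1, h2, h3⟩
    · exact .inl (code_inj (hB x h1) (hB q hq) h2 h3)
  · rintro (rfl | ⟨h1, h2, h3⟩)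
    · exact ⟨hq, by omega, rfl⟩
    · exact ⟨h1, by omega, h3⟩

theorem counter_succ_of_forall {t i : ℕ}
    (h : ∀ q < N, q % D = t → code D B key q ≠ i) :
    counter N D B key (t + 1) i = counter N D B key t i := by
  rw [counter, counter]
  congr 1
  refine Finset.filter_congr fun q hq => ?_
  have := h q (Finset.mem_range.1 hq)
  constructor
  · rintro ⟨h2, h3⟩
    exact ⟨(Nat.lt_succ_iff_lt_or_eq.1 h2).resolve_right fun h2 => this h2 h3, h3⟩
  · rintro ⟨h2, h3⟩
    exact ⟨by omega, h3⟩

/-- All offsets are below `D`, so after `D` rounds every position has been counted, and prefix sums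
of the counters count positions of smaller code. -/
theorem sum_counter (hD : 0 < D) (k : ℕ) :
    ∑ i ∈ Finset.range k, counter N D B key D i = countBelow N (code D B key) k := by
  rw [countBelow, Finset.card_eq_sum_card_fiberwise (f := code D B key) (t := Finset.range k)]
  · refine Finset.sum_congr rfl fun i hi => ?_
    rw [counter, Finset.filter_filter]
    congr 1
    refine Finset.filter_congr fun q _ => ?_
    have := Nat.mod_lt q hD
    have := Finset.mem_range.1 hi
    constructor
    · rintro ⟨_, rfl⟩; exact ⟨by omega, rfl⟩
    · rintro ⟨_, rfl⟩; exact ⟨by omega, rfl⟩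
  · intro q hq
    simpa using (Finset.mem_filter.1 hq).2

/-- The order is lexicographic in code and offset. The first summand comes from the scan, the second
is the counter value read just before `q` itself was counted. -/
theorem rank_eq (hD : 0 < D) (q : ℕ) :
    rank N (fun q => code D B key q * D + q % D) q =
      countBelow N (code D B key) (code D B key q) +
        counter N D B key (q % D) (code D B key q) := by
  rw [rank, countBelow, counter, ← Finset.card_union_of_disjoint, ← Finset.filter_or]
  · congr 1
    refine Finset.filter_congr fun x _ => ?_
    have hx := Nat.mod_lt x hD
    have hq := Nat.mod_lt q hD
    constructor
    · intro h
      rcases lt_trichotomy (code D B key x) (code D B key q) with h1 | h1 | h1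
      · exact .inl h1
      · rw [h1] at h
        exact .inr ⟨by omega, h1⟩
      · have := Nat.mul_le_mul_right D (Nat.succ_le_of_lt h1)
        rw [Nat.succ_mul] at this
        omega
    · rintro (h1 | ⟨h1, h2⟩)
      · have := Nat.mul_le_mul_right D (Nat.succ_le_of_lt h1)
        rw [Nat.succ_mul] at this
        omega
      · rw [h2]; omega
  · refine Finset.disjoint_filter.2 fun x _ h1 h2 => ?_
    omega

/-- Codes of key `j` fill only `[j * B, (j + 1) * B)`, so the scan at `j * B` is the start of group
`j`. -/
theorem countBelow_code (hB : ∀ q < N, q / D < B) (j : ℕ) :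
    countBelow N (code D B key) (j * B) = countBelow N key j := by
  rw [countBelow, countBelow]
  congr 1
  refine Finset.filter_congr fun q hq => ?_
  have h1 := hB q (Finset.mem_range.1 hq)
  rw [code]
  constructor
  · intro h
    by_contra hlt
    exact absurd ((Nat.mul_le_mul_right B (not_lt.1 hlt)).trans (Nat.le_add_right _ _)) h.not_ge
  · intro h
    have := Nat.mul_le_mul_right B (Nat.succ_le_of_lt h)
    rw [Nat.succ_mul] at this
    omega

theorem order_injOn (hD : 0 < D) (hB : ∀ q < N, q / D < B) :
    Set.InjOn (fun q => code D B key q * D + q % D) (Finset.range N) := by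
  intro q hq q' hq' h
  simp only [Finset.coe_range, Set.mem_Iio] at hq hq'
  dsimp only at h
  have h1 := congrArg (· % D) h
  have h2 := congrArg (· / D) h
  simp only [Nat.mul_add_mod_of_lt (Nat.mod_lt _ hD)] at h1
  simp only [Nat.mul_comm _ D, Nat.mul_add_div hD, Nat.div_eq_of_lt (Nat.mod_lt _ hD)] at h2
  exact code_inj (hB q hq) (hB q' hq') h1 (by simpa using h2)

end count

/-! ### Parallel counting sort -/

/-- The position of offset `t` (register `16`) in the block of the processor. -/
def Term.blockPos : Term := .idx * .reg 6 + .reg 16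

/-- The leaf that counts the key of that position in its block. -/
def Term.blockLeaf : Term := .reg 5 + (.get 14 .blockPos * .reg 15 + .idx)

/-- Stable counting sort of the positions by key: array `20` is the sorted order, and array `19`
holds the group boundaries. -/
def Cmd.sort : Cmd :=
  .seq (.assign 15 (.reg 4 / .reg 6 + .const 1)) <|
  .seq (.loop (.bin .lt (.reg 16) (.reg 6)) <|
    .seq (.intStep 17 (.reg 15) (.bin .lt .blockPos (.reg 4)) .blockPos (.get 18 .blockLeaf)) <|
    .seq (.intStep 18 (.reg 15) (.bin .lt .blockPos (.reg 4)) .blockLeaf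
      (.get 18 .blockLeaf + .const 1)) <|
    .assign 16 (.reg 16 + .const 1)) <|
  .seq (.scan 18 19) <|
  .intStep 20 (.reg 4) (.const 1)
    (.get 19 (.reg 5 + (.get 14 .idx * .reg 15 + .idx / .reg 6)) + .get 17 .idx) .idx

/-- One processor walks through each block, so there are `D` rounds with `B` processors. Each saves
the old counter before the increment, which gives the number of earlier positions of the same key in
its block. -/
theorem reaches_countLoop {N D B : ℕ} (hD : 0 < D) (hB : ∀ q < N, q / D < B)
    (h4 : s.ints 4 0 = N) (h5 : s.ints 5 0 = 2 ^ D) (h6 : s.ints 6 0 = D) (h15 : s.ints 15 0 = B)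
    (h16 : s.ints 16 0 = 0) (h18 : ∀ x, s.ints 18 x = 0) (hP : N + D + 1 ≤ M.wordBound) :
    Reaches M (.loop (.bin .lt (.reg 16) (.reg 6)) <|
      .seq (.intStep 17 (.reg 15) (.bin .lt .blockPos (.reg 4)) .blockPos (.get 18 .blockLeaf)) <|
      .seq (.intStep 18 (.reg 15) (.bin .lt .blockPos (.reg 4)) .blockLeaf
        (.get 18 .blockLeaf + .const 1)) <|
      .assign 16 (.reg 16 + .const 1)) s (5 + D * (17 + 81 * B)) (5 + D * 98) (fun I X =>
      X = s.nums ∧ (∀ A, A ∉ [16, 17, 18] → I A = s.ints A) ∧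
      (∀ x, I 18 (2 ^ D + x) = counter N D B (s.ints 14) D x) ∧
      ∀ q < N, I 17 q = counter N D B (s.ints 14) (q % D) (code D B (s.ints 14) q)) := by
  set key := s.ints 14 with hkey
  refine reaches_loop (k := D) (Inv := fun r I X => r ≤ D ∧
    X = s.nums ∧ (∀ A, A ∉ [16, 17, 18] → I A = s.ints A) ∧ I 16 0 = D - r ∧
      (∀ x, I 18 (2 ^ D + x) = counter N D B key (D - r) x) ∧
      ∀ q < N, q % D < D - r → I 17 q = counter N D B key (q % D) (code D B key q))
    (fun r => 5 + r * (17 + 81 * B)) (fun r => 5 + r * 98) ?_ ?_ ?_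
  · rintro r s' ⟨hr, hX, hfr, h16', h18', h17'⟩ hb
    have hr0 : r = 0 := by
      simp [h16', hfr 6 (by simp), h6] at hb
      omega
    subst hr0
    exact ⟨by simp, by simp, hX, hfr, h18', fun q hq => h17' q hq (Nat.mod_lt _ hD)⟩
  · rintro r s₁ ⟨hr, hX, hfr, h16', h18', h17'⟩ hb
    obtain ⟨r, rfl⟩ : ∃ j, r = j + 1 := by
      refine Nat.exists_eq_succ_of_ne_zero ?_
      rintro rfl
      simp [h16', hfr 6 (by simp), h6] at hb
    obtain ⟨t, ht⟩ : ∃ t, t = D - (r + 1) := ⟨_, rfl⟩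
    have htD : t < D := by omega
    have ht1 : D - r = t + 1 := by omega
    rw [← ht] at h16' h18' h17'
    have hpos : ∀ s' : State, (∀ A, A ∉ [17, 18] → s'.ints A = s₁.ints A) → ∀ b,
        Term.blockPos.eval s' b = b * D + t ∧
        Term.blockLeaf.eval s' b = 2 ^ D + (key (b * D + t) * B + b) ∧
        (Term.bin .lt .blockPos (.reg 4)).eval s' b = if b * D + t < N then 1 else 0 := by
      intro s' hs' b
      have e4 : s'.ints 4 0 = N := by rw [hs' _ (by simp), hfr _ (by simp), h4]
      have e5 : s'.ints 5 0 = 2 ^ D := by rw [hs' _ (by simp), hfr _ (by simp), h5]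
      have e6 : s'.ints 6 0 = D := by rw [hs' _ (by simp), hfr _ (by simp), h6]
      have e15 : s'.ints 15 0 = B := by rw [hs' _ (by simp), hfr _ (by simp), h15]
      have e16 : s'.ints 16 0 = t := by rw [hs' _ (by simp), h16']
      have e14 : s'.ints 14 = key := by rw [hs' _ (by simp), hfr _ (by simp)]
      simp [Term.blockPos, Term.blockLeaf, e4, e5, e6, e14, e15, e16]
    have hcode : ∀ b < B, b * D + t < N → key (b * D + t) * B + b = code D B key (b * D + t) ∧
        (b * D + t) % D = t := by
      intro b hb _
      refine ⟨?_, Nat.mul_add_mod_of_lt htD⟩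
      rw [code, Nat.mul_comm b D, Nat.mul_add_div hD, Nat.div_eq_of_lt htD, add_zero]
    have hwr : ∀ q < N, q % D = t → ∃ b < B, b * D + t = q := by
      intro q hq hqt
      refine ⟨q / D, hB q hq, ?_⟩
      rw [← hqt, Nat.mul_comm]
      exact Nat.div_add_mod q D
    refine ⟨r, by omega, 12 + 81 * B, 93, ?_, ?_, ?_⟩
    · refine Reaches.mono (Reaches.seq (W₂ := 10 + 46 * B) (D₂ := 56)
        (reaches_intStep 17 _ _ _ _ (k := B) (by simp [hfr, h15])
          (fun q => if q < N ∧ q % D = t then counter N D B key t (code D B key q)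
            else s₁.ints 17 q) ?_ ?_) ?_) ?_ ?_ fun I X h => h
      · intro b hb hg
        obtain ⟨e1, e2, e3⟩ := hpos s₁ (fun A _ => rfl) b
        rw [e3] at hg
        have hq : b * D + t < N := by
          by_contra hq; simp [hq] at hg
        obtain ⟨e5, e6⟩ := hcode b hb hq
        rw [Term.eval_get, e1, e2, if_pos ⟨hq, e6⟩, h18', e5]
        exact ⟨rfl, (counter_le _ _).trans (by omega)⟩
      · intro x hx
        refine if_neg ?_
        rintro ⟨hxN, hxt⟩
        obtain ⟨b, hb, rfl⟩ := hwr x hxN hxt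
        obtain ⟨e1, e2, e3⟩ := hpos s₁ (fun A _ => rfl) b
        exact hx b hb (by rw [e3, if_pos hxN]; simp) e1
      · rintro s₂ ⟨hI₂, hX₂⟩
        have hp2 := hpos s₂ (fun A hA => by
          simp only [List.mem_cons, List.not_mem_nil, or_false, not_or] at hA
          rw [hI₂, Function.update_of_ne hA.1])
        have h18₂ : s₂.ints 18 = s₁.ints 18 := by rw [hI₂, Function.update_of_ne (by simp)]
        refine Reaches.mono (Reaches.seq (W₂ := 8) (D₂ := 8)
          (reaches_intStep 18 _ _ _ _ (k := B) (by simp [hI₂, hfr, h15])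
            (fun x => if 2 ^ D ≤ x then counter N D B key (t + 1) (x - 2 ^ D)
              else s₁.ints 18 x) ?_ ?_) ?_) ?_ ?_ fun I X h => h
        · intro b hb hg
          obtain ⟨e1, e2, e3⟩ := hp2 b
          rw [e3] at hg
          have hq : b * D + t < N := by
            by_contra hq; simp [hq] at hg
          obtain ⟨e5, e6⟩ := hcode b hb hq
          have hc := counter_succ (key := key) hB hq
          rw [e6] at hc
          rw [Term.eval_add, Term.eval_get, Term.eval_const, e2, if_pos (by omega), h18₂, h18', e5,
            Nat.add_sub_cancel_left, hc]
          refine ⟨rfl, ?_⟩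
          have := counter_le (N := N) (D := D) (B := B) (key := key) t (code D B key (b * D + t))
          omega
        · intro x hx
          rw [h18₂]
          split_ifs with h
          · obtain ⟨i, rfl⟩ := Nat.exists_eq_add_of_le h
            rw [Nat.add_sub_cancel_left, h18']
            refine counter_succ_of_forall fun q hq hqt hqi => ?_
            obtain ⟨b, hb, rfl⟩ := hwr q hq hqt
            obtain ⟨e1, e2, e3⟩ := hp2 b
            refine hx b hb (by rw [e3, if_pos hq]; simp) ?_
            rw [e2, (hcode b hb hq).1, hqi]
          · rfl
        · rintro s₃ ⟨hI₃, hX₃⟩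
          refine (reaches_assign 16 _ (v := t + 1) (by simp [hI₃, hI₂, h16']) (by omega)).mono
            (by simp) (by simp) ?_
          rintro I X ⟨rfl, rfl⟩
          rw [ht1]
          refine ⟨by omega, by rw [hX₃, hX₂, hX], fun A hA => ?_, by simp, fun x => ?_,
            fun q hq hqt => ?_⟩
          · have hA' := hA
            simp only [List.mem_cons, List.not_mem_nil, or_false, not_or] at hA'
            simp [hI₃, hI₂, hA', hfr A hA]
          · simp [hI₃]
          · simp only [hI₃, hI₂, Nat.reduceEqDiff, Function.update, dite_eq_ite, if_true, if_false,
              eq_rec_constant, hq, true_and]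
            split_ifs with h
            · rw [h]
            · exact h17' q hq (by omega)
        · simp [Term.blockPos, Term.blockLeaf]; omega
        · simp [Term.blockPos, Term.blockLeaf]
      · simp [Term.blockPos, Term.blockLeaf]; omega
      · simp [Term.blockPos, Term.blockLeaf]
    · simp only [Term.cost_bin, Term.cost_reg]; rw [Nat.succ_mul r]; omega
    · simp; omega
  · refine ⟨le_rfl, rfl, fun A _ => rfl, by simp [h16], fun x => ?_, fun q _ hq => by simp at hq⟩
    simp [h18, counter]

/-- Block length `D` balances the sort: `D` keys times `N / D + 1` blocks make at most `N + D`
counters, and a block needs only `D` sequential rounds. -/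
theorem reaches_sort {N D : ℕ} (hD : 0 < D) (hN : 0 < N) (hND : 4 * N ≤ 2 ^ D)
    (h4 : s.ints 4 0 = N) (h5 : s.ints 5 0 = 2 ^ D) (h6 : s.ints 6 0 = D)
    (h16 : s.ints 16 0 = 0) (h18 : ∀ x, s.ints 18 x = 0) (h19 : s.ints 19 1 = 0)
    (hkey : ∀ q < N, s.ints 14 q < D) (hP : 2 ^ D ≤ M.wordBound) :
    Reaches M .sort s (40 + 250 * 2 ^ D) (60 + 210 * D) (fun I X =>
      X = s.nums ∧ (∀ A, A ∉ [10, 15, 16, 17, 18, 19, 20] → I A = s.ints A) ∧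
      (∀ j ≤ D, I 19 (2 ^ D + j * I 15 0) = countBelow N (s.ints 14) j) ∧
      ∀ j (g : ℕ → ℝ),
        ∑ i ∈ Finset.range (countBelow N (s.ints 14) (j + 1) - countBelow N (s.ints 14) j),
          g (I 20 (countBelow N (s.ints 14) j + i)) =
        ∑ q ∈ (Finset.range N).filter (fun q => s.ints 14 q = j), g q) := by
  set key := s.ints 14 with hk
  set B := N / D + 1 with hBdef
  have hB : ∀ q < N, q / D < B := fun q hq => div_lt_blocks hq
  have hDP : 2 * D ≤ 2 ^ D := by
    obtain ⟨e, rfl⟩ : ∃ e, D = e + 1 := ⟨D - 1, by omega⟩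
    have : e < 2 ^ e := Nat.lt_two_pow_self
    rw [pow_succ]; omega
  have hBD : D * B ≤ N + D := by
    rw [hBdef, mul_add, mul_one]
    have := Nat.mul_div_le N D
    omega
  have hNB : N / D ≤ N := Nat.div_le_self _ _
  have hDB : D * (17 + 81 * B) = 17 * D + 81 * (D * B) := by ring
  refine reaches_assign_seq B (25 + 249 * 2 ^ D) (45 + 210 * D) (by simp [h4, h6, hBdef]) (by omega)
    (by simp; omega) (by simp; omega) fun s₁ hI₁ hX₁ => ?_
  have hk₁ : s₁.ints 14 = key := by simp [hI₁, hk]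
  refine Reaches.mono (Reaches.seq (W₂ := 15 + 130 * 2 ^ D) (D₂ := 40 + 110 * D)
    (reaches_countLoop (N := N) (B := B) hD hB
      (by simp [hI₁, h4]) (by simp [hI₁, h5]) (by simp [hI₁, h6]) (by simp [hI₁])
      (by simp [hI₁, h16]) (by simp [hI₁, h18]) (by omega)) ?_) ?_ ?_ fun I X h => h
  · rintro s₂ ⟨hX₂, hfr₂, h18₂, h17₂⟩
    rw [hk₁] at h18₂ h17₂
    have hs₂ : ∀ A, A ∉ [15, 16, 17, 18] → s₂.ints A = s.ints A := fun A hA => by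
      simp only [List.mem_cons, List.not_mem_nil, or_false, not_or] at hA
      rw [hfr₂ A (by simp [hA]), hI₁, Function.update_of_ne hA.1]
    have hB₂ : s₂.ints 15 0 = B := by simp [hfr₂, hI₁]
    refine Reaches.mono (Reaches.seq (W₂ := 2 + 22 * N) (D₂ := 25)
      (reaches_scan (T := 18) (S := 19) (counter N D B key D) (by simp) (by simp) (by simp)
      (by simp) (by simp) (by simp [hs₂, h5]) (by simp [hs₂, h19]) (D := D)
      (fun x _ => h18₂ x) ?_ hP) ?_) ?_ ?_ fun I X h => h
    · rw [sum_counter hD]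
      exact (countBelow_le _).trans (by omega)
    · rintro s₃ ⟨hX₃, hfr₃, -, hS₃⟩
      have hs₃ : ∀ A, A ∉ [10, 15, 16, 17, 18, 19] → s₃.ints A = s.ints A := fun A hA => by
        simp only [List.mem_cons, List.not_mem_nil, or_false, not_or] at hA
        rw [hfr₃ A hA.2.2.2.2.1 hA.2.2.2.2.2 hA.1, hs₂ A (by simp [hA])]
      have hB₃ : s₃.ints 15 0 = B := by rw [hfr₃ _ (by simp) (by simp) (by simp), hB₂]
      have hlt : ∀ k, k ≤ D * B → s₃.ints 19 (2 ^ D + k) = countBelow N (code D B key) k :=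
        fun k hk => by rw [hS₃ k (by omega), sum_counter hD]
      set F : ℕ → ℕ := fun q => code D B key q * D + q % D with hF
      have hcode : ∀ q < N, code D B key q < D * B := fun q hq => by
        have h1 := Nat.mul_le_mul_right B (Nat.succ_le_of_lt (hkey q hq))
        have h2 := hB q hq
        rw [Nat.succ_mul] at h1
        exact lt_of_lt_of_le (Nat.add_lt_add_left h2 _) h1
      have haddr : ∀ q < N, s₃.ints 19 (2 ^ D + (key q * B + q / D)) + s₃.ints 17 q =
          rank N F q := fun q hq => by
        rw [hF, rank_eq hD, hfr₃ 17 (by simp) (by simp) (by simp), h17₂ q hq]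
        congr 1
        exact hlt _ (hcode q hq).le
      have hinj := order_injOn (key := key) hD hB
      -- The inverse of the rank on its image. Elsewhere it must be the old memory, since no
      -- processor writes there.
      obtain ⟨perm, hperm, hperm'⟩ : ∃ perm : ℕ → ℕ, (∀ q < N, perm (rank N F q) = q) ∧
          ∀ x, (¬ ∃ q < N, rank N F q = x) → perm x = s₃.ints 20 x := by
        classical
        refine ⟨fun x => if h : ∃ q < N, rank N F q = x then h.choose else s₃.ints 20 x,
          fun q hq => ?_, fun x hx => dif_neg hx⟩
        have h : ∃ q' < N, rank N F q' = rank N F q := ⟨q, hq, rfl⟩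
        dsimp only
        rw [dif_pos h]
        exact rank_injOn hinj (by simpa using h.choose_spec.1) (by simpa using hq)
          h.choose_spec.2
      refine (reaches_intStep 20 _ _ _ _ (k := N) (by simp [hs₃, h4]) perm ?_ ?_).mono ?_ ?_ ?_
      · intro q hq _
        simp only [Term.eval_add, Term.eval_get, Term.eval_mul, Term.eval_div, Term.eval_reg,
          Term.eval_idx, hs₃ 5 (by simp), hs₃ 6 (by simp), hs₃ 14 (by simp), h5, h6, hB₃, ← hk,
          haddr q hq]
        exact ⟨(hperm q hq).symm, by omega⟩
      · intro x hx
        refine hperm' x ?_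
        rintro ⟨q, hq, hqx⟩
        refine hx q hq (by simp) ?_
        simp only [Term.eval_add, Term.eval_get, Term.eval_mul, Term.eval_div, Term.eval_reg,
          Term.eval_idx, hs₃ 5 (by simp), hs₃ 6 (by simp), hs₃ 14 (by simp), h5, h6, hB₃, ← hk,
          haddr q hq, hqx]
      · simp; omega
      · simp
      · rintro I X ⟨rfl, rfl⟩
        refine ⟨by rw [hX₃, hX₂, hX₁], fun A hA => ?_, fun j hj => ?_, fun j g => ?_⟩
        · simp only [List.mem_cons, List.not_mem_nil, or_false, not_or] at hA
          simp [hA, hs₃]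
        · simp only [Function.update_of_ne (show (19 : ℕ) ≠ 20 by simp),
            Function.update_of_ne (show (15 : ℕ) ≠ 20 by simp), hB₃]
          rw [hlt _ (Nat.mul_le_mul_right B hj), countBelow_code hB]
        · simp only [Function.update_self]
          refine sum_rank_group hinj (fun q hq q' _ hqq => ?_) perm hperm j g
          have h1 : code D B key q < code D B key q' := by
            have h1 := Nat.mul_le_mul_right B (Nat.succ_le_of_lt hqq)
            rw [Nat.succ_mul] at h1
            have h2 := hB q hq
            exact lt_of_lt_of_le (Nat.add_lt_add_left h2 _) (h1.trans (Nat.le_add_right _ _))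
          have h2 := Nat.mul_le_mul_right D (Nat.succ_le_of_lt h1)
          rw [Nat.succ_mul] at h2
          have h3 := Nat.mod_lt q hD
          change code D B key q * D + q % D < code D B key q' * D + q' % D
          omega
    · omega
    · omega
  · omega
  · omega

/-! ### Parallel summation of numbers -/

/-- Sums the first `len` cells of number array `2` into its first cell, with `len` in register `24`. -/
def Cmd.reduce : Cmd :=
  .loop (.bin .lt (.const 1) (.reg 24)) <|
    .seq (.numStep 2 (.reg 24 / .const 2) (.const 1) .idx
      (.add (.get 2 .idx) (.get 2 ((.reg 24 + .const 1) / .const 2 + .idx)))) <|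
    .assign 24 ((.reg 24 + .const 1) / .const 2)

theorem sum_fold {h k : ℕ} (hk : h ≤ k) (Y : ℕ → ℝ) :
    ∑ i ∈ Finset.range k, (Y i + if i < h then Y (k + i) else 0) =
      ∑ i ∈ Finset.range (k + h), Y i := by
  rw [Finset.sum_add_distrib, Finset.sum_range_add, ← Finset.sum_filter]
  congr 2
  ext i
  simp only [Finset.mem_filter, Finset.mem_range]
  omega

/-- The upper half is folded onto the lower one, with the middle cell left alone for odd lengths.
The sum is preserved, and by the triangle inequality the sum of absolute values never grows, which
bounds every intermediate number. -/
theorem reaches_reduce {len : ℕ} (hlen : 0 < len) (h24 : s.ints 24 0 = len)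
    (hb : ∑ i ∈ Finset.range len, |s.nums 2 i| ≤ M.numBound) (hP : len ≤ M.wordBound) :
    Reaches M .reduce s (4 + 33 * len) (4 + 33 * Nat.clog 2 len) (fun I X =>
      (∀ A, A ≠ 24 → I A = s.ints A) ∧ (∀ A, A ≠ 2 → X A = s.nums A) ∧
      X 2 0 = ∑ i ∈ Finset.range len, s.nums 2 i) := by
  refine reaches_loop (k := len) (Inv := fun k I X => 0 < k ∧ k ≤ len ∧ I 24 0 = k ∧
      (∀ A, A ≠ 24 → I A = s.ints A) ∧ (∀ A, A ≠ 2 → X A = s.nums A) ∧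
      ∑ i ∈ Finset.range k, X 2 i = ∑ i ∈ Finset.range len, s.nums 2 i ∧
      ∑ i ∈ Finset.range k, |X 2 i| ≤ M.numBound)
    (fun k => 4 + 33 * k) (fun k => 4 + 33 * Nat.clog 2 k) ?_ ?_ ?_
  · rintro k s' ⟨hk0, -, h24', hI, hX, hsum, -⟩ hb
    have hk1 : k = 1 := by
      simp [h24'] at hb
      omega
    subst hk1
    exact ⟨by simp, by simp, hI, hX, by simpa using hsum⟩
  · rintro k s₁ ⟨hk0, hkl, h24', hI, hX, hsum, habs⟩ hb
    have hk2 : 2 ≤ k := by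
      by_contra hk2
      simp [h24'] at hb
      omega
    obtain ⟨h, hh⟩ : ∃ h, h = k / 2 := ⟨_, rfl⟩
    obtain ⟨m, hm⟩ : ∃ m, m = (k + 1) / 2 := ⟨_, rfl⟩
    have hmh : m + h = k := by omega
    have hclog : Nat.clog 2 k = Nat.clog 2 m + 1 := by
      rw [Nat.clog_of_two_le (by simp) hk2, hm, show k + 2 - 1 = k + 1 by omega]
    have hval : ∀ i, |s₁.nums 2 i + if i < h then s₁.nums 2 (m + i) else 0| ≤
        |s₁.nums 2 i| + if i < h then |s₁.nums 2 (m + i)| else 0 := by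
      intro i
      split_ifs
      · exact abs_add_le _ _
      · simp
    have habs' : ∑ i ∈ Finset.range m,
        |s₁.nums 2 i + if i < h then s₁.nums 2 (m + i) else 0| ≤ M.numBound := by
      refine (Finset.sum_le_sum fun i _ => hval i).trans ?_
      rw [sum_fold (by omega) fun i => |s₁.nums 2 i|, hmh]
      exact habs
    -- A round removes `h ≥ 1` cells, so a potential linear in the length also pays for its constant
    -- overhead.
    refine ⟨m, by omega, 14 + 15 * h, 29, ?_, ?_, ?_⟩
    · refine Reaches.mono (Reaches.seq (W₂ := 10) (D₂ := 10)
        (reaches_numStep 2 _ _ _ _ (k := h) (by simp [h24', hh])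
          (fun i => if i < h then s₁.nums 2 i + s₁.nums 2 (m + i) else s₁.nums 2 i) ?_ ?_) ?_) ?_ ?_
          fun I X h => h
      · intro i hi _
        simp only [NumTerm.eval_add, NumTerm.eval_get, Term.eval_idx, Term.eval_add, Term.eval_div,
          Term.eval_reg, Term.eval_const, h24', ← hm]
        refine ⟨(if_pos hi).symm, le_trans ?_ habs'⟩
        have := Finset.single_le_sum
          (f := fun i => |s₁.nums 2 i + if i < h then s₁.nums 2 (m + i) else 0|)
          (fun i _ => abs_nonneg _) (Finset.mem_range.2 (show i < m by omega))
        simpa [hi] using this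
      · intro x hx
        refine if_neg fun hxh => hx x hxh (by simp) (by simp)
      · rintro s₂ ⟨hI₂, hX₂⟩
        refine (reaches_assign 24 _ (v := m) (by simp [hI₂, h24', hm]) (by omega)).mono
          (by simp) (by simp) ?_
        rintro I X ⟨rfl, rfl⟩
        have hX2 : s₂.nums 2 = fun i => s₁.nums 2 i + if i < h then s₁.nums 2 (m + i) else 0 := by
          rw [hX₂, Function.update_self]
          funext i
          split_ifs <;> simp
        refine ⟨by omega, by omega, by simp, fun A hA => ?_, fun A hA => ?_, ?_, ?_⟩
        · simp [hA, hI₂, hI A hA]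
        · simp [hA, hX₂, hX A hA]
        · rw [hX2, sum_fold (by omega), hmh, hsum]
        · rw [hX2]
          exact habs'
      · simp; omega
      · simp
    · simp; omega
    · simp [hclog]; omega
  · exact ⟨hlen, le_rfl, h24, fun _ _ => rfl, fun _ _ => rfl, rfl, hb⟩

/-! ### Fixing one bit of the labelling -/

/-- The weight of position `q`, counted negatively if its ends are separated by the labels `T`. -/
def signedWeight (U V : ℕ → ℕ) (wt : ℕ → ℝ) (T : ℕ → ℕ) (p q : ℕ) : ℝ :=
  if T (U q / p) = T (V q / p) then wt q else -wt q

theorem abs_signedWeight {U V : ℕ → ℕ} {wt : ℕ → ℝ} {T : ℕ → ℕ} {p q : ℕ} (h : 0 ≤ wt q) :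
    |signedWeight U V wt T p q| = wt q := by
  unfold signedWeight
  split_ifs <;> simp [abs_of_nonneg h]

theorem two_pow_dvd_dist_iff {u v j : ℕ} :
    2 ^ j ∣ (u - v) + (v - u) ↔ u % 2 ^ j = v % 2 ^ j := by
  rcases le_total u v with h | h
  · rw [Nat.sub_eq_zero_of_le h, zero_add]
    exact (Nat.modEq_iff_dvd' h).symm
  · rw [Nat.sub_eq_zero_of_le h, add_zero, eq_comm]
    exact (Nat.modEq_iff_dvd' h).symm

/-- The valuation of the distance is the number of low bits in which `u` and `v` agree. Equal ends
are excluded because `padicValNat 2 0 = 0`. -/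
theorem le_padicValNat_dist_iff {u v j : ℕ} (h : u ≠ v) :
    j ≤ padicValNat 2 ((u - v) + (v - u)) ↔ u % 2 ^ j = v % 2 ^ j := by
  rw [← two_pow_dvd_dist_iff, padicValNat_dvd_iff_le (by omega)]

theorem mod_two_pow_succ_iff {u v j : ℕ} :
    u % 2 ^ (j + 1) = v % 2 ^ (j + 1) ↔
      u % 2 ^ j = v % 2 ^ j ∧ u / 2 ^ j % 2 = v / 2 ^ j % 2 := by
  rw [Nat.mod_pow_succ, Nat.mod_pow_succ]
  constructor
  · intro h
    have hp : 0 < 2 ^ j := by positivity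
    have h1 := congrArg (· % 2 ^ j) h
    simp only [Nat.add_mul_mod_self_left, Nat.mod_mod] at h1
    rw [h1] at h
    exact ⟨h1, Nat.eq_of_mul_eq_mul_left hp (Nat.add_left_cancel h)⟩
  · rintro ⟨h1, h2⟩
    rw [h1, h2]

/-- Refinement of the labels by one bit. -/
def refineLabel (T : ℕ → ℕ) (r x : ℕ) : ℕ := (T (x / 2) + x % 2 * r) % 2

theorem refineLabel_le (T : ℕ → ℕ) (r x : ℕ) : refineLabel T r x ≤ 1 :=
  Nat.le_of_lt_succ (Nat.mod_lt _ two_pos)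

theorem refineLabel_eq_iff_of_eq {T : ℕ → ℕ} (hT : ∀ x, T x ≤ 1) {r x y : ℕ}
    (h : x % 2 = y % 2) : refineLabel T r x = refineLabel T r y ↔ T (x / 2) = T (y / 2) := by
  have h1 := hT (x / 2)
  have h2 := hT (y / 2)
  rw [refineLabel, refineLabel, h]
  omega

theorem refineLabel_zero_eq_iff {T : ℕ → ℕ} (hT : ∀ x, T x ≤ 1) {x y : ℕ} :
    refineLabel T 0 x = refineLabel T 0 y ↔ T (x / 2) = T (y / 2) := by
  have h1 := hT (x / 2)
  have h2 := hT (y / 2)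
  rw [refineLabel, refineLabel]
  omega

/-- Exactly one of the two labels is flipped when the last bits differ. -/
theorem refineLabel_one_eq_iff {T : ℕ → ℕ} (hT : ∀ x, T x ≤ 1) {x y : ℕ}
    (h : x % 2 ≠ y % 2) : refineLabel T 1 x = refineLabel T 1 y ↔ T (x / 2) ≠ T (y / 2) := by
  have h1 := hT (x / 2)
  have h2 := hT (y / 2)
  rw [refineLabel, refineLabel]
  omega

/-- The inductive step of the derandomization. Positions of key above `j` keep their sign, since
their ends share bit `j`. In group `j` the choice `r = 0` keeps the sum and `r = 1` negates it, and
`r` is chosen by its sign. Positions of weight zero are exempt from the condition on keys, which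
admits the heads. -/
theorem sum_signedWeight_refine {N j r : ℕ} {U V key : ℕ → ℕ} {wt : ℕ → ℝ} {T T' : ℕ → ℕ}
    (hT : ∀ x, T x ≤ 1)
    (hq : ∀ q < N, wt q = 0 ∨
      U q ≠ V q ∧ key q = padicValNat 2 ((U q - V q) + (V q - U q)))
    (hT' : ∀ q < N, T' (U q / 2 ^ j) = refineLabel T r (U q / 2 ^ j) ∧
      T' (V q / 2 ^ j) = refineLabel T r (V q / 2 ^ j))
    (hr : r = if ∑ q ∈ (Finset.range N).filter (fun q => key q = j),
      signedWeight U V wt T (2 ^ (j + 1)) q < 0 then 0 else 1)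
    (hsum : ∑ q ∈ (Finset.range N).filter (fun q => j + 1 ≤ key q),
      signedWeight U V wt T (2 ^ (j + 1)) q ≤ 0) :
    ∑ q ∈ (Finset.range N).filter (fun q => j ≤ key q),
      signedWeight U V wt T' (2 ^ j) q ≤ 0 := by
  have hdiv : ∀ u, u / 2 ^ j / 2 = u / 2 ^ (j + 1) := fun u => by
    rw [Nat.div_div_eq_div_mul, pow_succ]
  have hsplit : (Finset.range N).filter (fun q => j ≤ key q) =
      (Finset.range N).filter (fun q => j + 1 ≤ key q) ∪
        (Finset.range N).filter (fun q => key q = j) := by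
    rw [← Finset.filter_or]
    exact Finset.filter_congr fun q _ => by omega
  rw [hsplit, Finset.sum_union (Finset.disjoint_filter.2 fun q _ _ _ => by omega)]
  have h1 : ∑ q ∈ (Finset.range N).filter (fun q => j + 1 ≤ key q),
      signedWeight U V wt T' (2 ^ j) q ≤ 0 := by
    refine le_of_eq_of_le (Finset.sum_congr rfl fun q hqm => ?_) hsum
    obtain ⟨hqN, hk⟩ := Finset.mem_filter.1 hqm
    rw [Finset.mem_range] at hqN
    rcases hq q hqN with h0 | ⟨hne, hkey⟩
    · simp [signedWeight, h0]
    · rw [hkey, le_padicValNat_dist_iff hne, mod_two_pow_succ_iff] at hk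
      simp only [signedWeight, (hT' q hqN).1, (hT' q hqN).2, refineLabel_eq_iff_of_eq hT hk.2, hdiv]
  have h2 : ∑ q ∈ (Finset.range N).filter (fun q => key q = j),
      signedWeight U V wt T' (2 ^ j) q ≤ 0 := by
    split_ifs at hr with hneg
    · refine le_of_eq_of_le (Finset.sum_congr rfl fun q hqm => ?_) hneg.le
      obtain ⟨hqN, hk⟩ := Finset.mem_filter.1 hqm
      rw [Finset.mem_range] at hqN
      simp only [signedWeight, (hT' q hqN).1, (hT' q hqN).2, hr, refineLabel_zero_eq_iff hT, hdiv]
    · refine le_of_eq_of_le ?_ (neg_nonpos.2 (not_lt.1 hneg))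
      rw [← Finset.sum_neg_distrib]
      refine Finset.sum_congr rfl fun q hqm => ?_
      obtain ⟨hqN, hk⟩ := Finset.mem_filter.1 hqm
      rw [Finset.mem_range] at hqN
      rcases hq q hqN with h0 | ⟨hne, hkey⟩
      · simp [signedWeight, h0]
      · have hb : U q / 2 ^ j % 2 ≠ V q / 2 ^ j % 2 := by
          intro hb
          have h3 := (le_padicValNat_dist_iff hne (j := j)).1 (by omega)
          have h4 := (le_padicValNat_dist_iff hne).2 (mod_two_pow_succ_iff.2 ⟨h3, hb⟩)
          omega
        simp only [signedWeight, (hT' q hqN).1, (hT' q hqN).2, hr, refineLabel_one_eq_iff hT hb,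
          hdiv]
        split_ifs <;> simp_all
  linarith

/-! ### The levels of the algorithm -/

/-- The position in the sorted order that the processor handles in the current group. -/
def Term.itemPos : Term := .get 20 (.reg 23 + .idx)

/-- The address of its weight; beyond the group it is an address of weight zero. -/
def Term.itemSlot : Term := .ite (.bin .lt .idx (.reg 24)) (.get 13 .itemPos) (.get 1 (.reg 0))

/-- Whether both ends have the same label. -/
def Term.itemEq : Term :=
  .bin .eq (.get 3 (.get 11 .itemPos / .reg 22)) (.get 3 (.get 12 .itemPos / .reg 22))

/-- Loads the signed weights of the current group into number array `2`. -/
def Cmd.loadGroup : Cmd :=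
  .numStep 2 (.reg 24 + .const 1) (.const 1) .idx
    (.sub (.get 0 (.ite .itemEq .itemSlot (.get 1 (.reg 0))))
      (.get 0 (.ite .itemEq (.get 1 (.reg 0)) .itemSlot)))

/-- Fixes the next bit of the labelling so that at least half the weight of its group is cut. -/
def Cmd.level : Cmd :=
  .seq (.assign 21 (.reg 21 - .const 1)) <|
  .seq (.assign 23 (.get 19 (.reg 5 + .reg 21 * .reg 15))) <|
  .seq (.assign 24 (.get 19 (.reg 5 + (.reg 21 + .const 1) * .reg 15) - .reg 23)) <|
  .seq .loadGroup <|
  .seq (.assign 24 (.reg 24 + .const 1)) <|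
  .seq .reduce <|
  .seq (.assign 26 (.ite (.numLt 2 (.const 0) 3 (.const 0)) (.const 0) (.const 1))) <|
  .seq (.assign 22 (.reg 22 / .const 2)) <|
  .fill 3 (.reg 0 / .reg 22 + .const 1) (.const 0)
    ((.get 3 (.idx / .const 2) + .idx % .const 2 * .reg 26) % .const 2)

/-- Number expressions have no conditional, so the sign is produced by a difference of two cells,
one of them the zero at address `L`. The additional cell `g` holds zero and keeps the length
positive for `Cmd.reduce` when the group is empty. -/
theorem reaches_loadGroup {n L o g p : ℕ} {S : ℝ}
    (h0 : s.ints 0 0 = n) (h1 : s.ints 1 n = L) (hzero : s.nums 0 L = 0)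
    (h22 : s.ints 22 0 = p) (h23 : s.ints 23 0 = o) (h24 : s.ints 24 0 = g)
    (hnn : ∀ x, 0 ≤ s.nums 0 x)
    (hS : ∑ i ∈ Finset.range g, s.nums 0 (s.ints 13 (s.ints 20 (o + i))) ≤ S)
    (hP : S ≤ M.numBound) :
    Reaches M .loadGroup s (90 + 84 * g) 90 (fun I X => I = s.ints ∧
      (∀ A, A ≠ 2 → X A = s.nums A) ∧
      ∑ i ∈ Finset.range (g + 1), X 2 i = ∑ i ∈ Finset.range g,
        signedWeight (s.ints 11) (s.ints 12) (fun q => s.nums 0 (s.ints 13 q)) (s.ints 3) p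
          (s.ints 20 (o + i)) ∧
      ∑ i ∈ Finset.range (g + 1), |X 2 i| ≤ S) := by
  set wt : ℕ → ℝ := fun q => s.nums 0 (s.ints 13 q) with hwt
  set v : ℕ → ℝ := fun i => signedWeight (s.ints 11) (s.ints 12) wt (s.ints 3) p
    (s.ints 20 (o + i)) with hv
  have habs : ∀ i, |v i| = wt (s.ints 20 (o + i)) := fun i => abs_signedWeight (hnn _)
  refine (reaches_numStep 2 _ _ _ _ (k := g + 1) (by simp [h24])
    (fun i => if i < g then v i else if i = g then 0 else s.nums 2 i) ?_ ?_).mono ?_ ?_ ?_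
  · intro i hi _
    have hSM : ∀ i < g, |v i| ≤ M.numBound := fun i hi => by
      rw [habs]
      exact (Finset.single_le_sum (f := fun i => wt (s.ints 20 (o + i))) (fun i _ => hnn _)
        (Finset.mem_range.2 hi)).trans (hS.trans hP)
    have hM : 0 ≤ M.numBound := (Finset.sum_nonneg fun i _ => hnn _).trans (hS.trans hP)
    have hval : (NumTerm.sub (.get 0 (.ite .itemEq .itemSlot (.get 1 (.reg 0))))
        (.get 0 (.ite .itemEq (.get 1 (.reg 0)) .itemSlot))).eval s i =
        if i < g then v i else if i = g then 0 else s.nums 2 i := by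
      simp only [hv, signedWeight, hwt, NumTerm.eval_sub, NumTerm.eval_get, Term.eval_ite,
        Term.itemEq, Term.itemSlot, Term.itemPos, Term.eval_eq, Term.eval_lt, Term.eval_get,
        Term.eval_add, Term.eval_div, Term.eval_reg, Term.eval_idx, h0, h1, h22, h23, h24]
      by_cases hig : i < g
      · by_cases he : s.ints 3 (s.ints 11 (s.ints 20 (o + i)) / p) =
          s.ints 3 (s.ints 12 (s.ints 20 (o + i)) / p) <;> simp [hig, he, hzero]
      · have : i = g := by omega
        simp [this, hzero]
    refine ⟨hval, ?_⟩
    rw [hval]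
    split_ifs with h2 h3
    · exact hSM i h2
    · simpa using hM
    · omega
  · intro x hx
    have hxg : ¬ x < g + 1 := fun h => hx x h (by simp) (by simp)
    rw [if_neg (by omega), if_neg (by omega)]
  · simp [Term.itemEq, Term.itemSlot, Term.itemPos]; omega
  · simp [Term.itemEq, Term.itemSlot, Term.itemPos]
  · rintro I X ⟨rfl, rfl⟩
    refine ⟨rfl, fun A hA => by rw [Function.update_of_ne hA], ?_, ?_⟩
    · rw [Finset.sum_range_succ, Function.update_self]
      simp only [lt_irrefl, if_false, if_true, add_zero]
      refine Finset.sum_congr rfl fun i hi => ?_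
      rw [if_pos (Finset.mem_range.1 hi)]
    · rw [Finset.sum_range_succ, Function.update_self]
      simp only [lt_irrefl, if_false, if_true, abs_zero, add_zero]
      refine le_of_eq_of_le (Finset.sum_congr rfl fun i hi => ?_) hS
      rw [if_pos (Finset.mem_range.1 hi), habs]

theorem reaches_level {n L N D j : ℕ} (hN : N + 1 ≤ 2 ^ D) (hD : 2 ^ D ≤ M.wordBound)
    (hjD : j < D)
    (h0 : s.ints 0 0 = n) (h1 : s.ints 1 n = L) (hzero : s.nums 0 L = 0) (h3 : s.nums 3 0 = 0)
    (h5 : s.ints 5 0 = 2 ^ D)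
    (h19 : ∀ j ≤ D, s.ints 19 (2 ^ D + j * s.ints 15 0) = countBelow N (s.ints 14) j)
    (h20 : ∀ j (g : ℕ → ℝ),
        ∑ i ∈ Finset.range (countBelow N (s.ints 14) (j + 1) - countBelow N (s.ints 14) j),
          g (s.ints 20 (countBelow N (s.ints 14) j + i)) =
        ∑ q ∈ (Finset.range N).filter (fun q => s.ints 14 q = j), g q)
    (hU : ∀ q < N, s.ints 11 q < n ∧ s.ints 12 q < n)
    (hq : ∀ q < N, s.nums 0 (s.ints 13 q) = 0 ∨ s.ints 11 q ≠ s.ints 12 q ∧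
      s.ints 14 q = padicValNat 2
        ((s.ints 11 q - s.ints 12 q) + (s.ints 12 q - s.ints 11 q)))
    (hnn : ∀ x, 0 ≤ s.nums 0 x)
    (hS : ∑ q ∈ Finset.range N, s.nums 0 (s.ints 13 q) ≤ M.numBound)
    (hT : ∀ x, s.ints 3 x ≤ 1) (h21 : s.ints 21 0 = j + 1) (h22 : s.ints 22 0 = 2 ^ (j + 1))
    (hsum : ∑ q ∈ (Finset.range N).filter (fun q => j + 1 ≤ s.ints 14 q),
      signedWeight (s.ints 11) (s.ints 12) (fun q => s.nums 0 (s.ints 13 q)) (s.ints 3)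
        (2 ^ (j + 1)) q ≤ 0) :
    Reaches M .level s
      (228 + 117 * (countBelow N (s.ints 14) (j + 1) - countBelow N (s.ints 14) j) +
        18 * (n / 2 ^ j)) (228 + 33 * D)
      (fun I X => (∀ A, A ∉ [3, 21, 22, 23, 24, 26] → I A = s.ints A) ∧
        (∀ A, A ≠ 2 → X A = s.nums A) ∧ I 21 0 = j ∧ I 22 0 = 2 ^ j ∧ (∀ x, I 3 x ≤ 1) ∧
        ∑ q ∈ (Finset.range N).filter (fun q => j ≤ s.ints 14 q),
          signedWeight (s.ints 11) (s.ints 12) (fun q => s.nums 0 (s.ints 13 q)) (I 3)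
            (2 ^ j) q ≤ 0) := by
  set key := s.ints 14 with hkey
  obtain ⟨o, ho⟩ : ∃ o, o = countBelow N key j := ⟨_, rfl⟩
  obtain ⟨g, hg⟩ : ∃ g, g = countBelow N key (j + 1) - countBelow N key j := ⟨_, rfl⟩
  have hoN : o ≤ N := by rw [ho]; exact countBelow_le _
  have hgN : g ≤ N := by
    have := countBelow_le (N := N) (key := key) (j + 1)
    omega
  have hjP : 2 ^ (j + 1) ≤ 2 ^ D := Nat.pow_le_pow_right (by simp) hjD
  have hj2 : 2 ^ (j + 1) = 2 ^ j * 2 := pow_succ 2 j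
  have hpos : 0 < 2 ^ j := by positivity
  have hjlt : D < 2 ^ D := Nat.lt_two_pow_self
  have hclog : Nat.clog 2 (g + 1) ≤ D := by
    rw [Nat.clog_le_iff_le_pow (by simp)]
    omega
  rw [← hg]
  refine reaches_assign_seq j (220 + 117 * g + 18 * (n / 2 ^ j)) (220 + 33 * D) (by simp [h21])
    (by omega) (by simp; omega) (by simp; omega) fun s₁ hI₁ hX₁ => ?_
  refine reaches_assign_seq o (207 + 117 * g + 18 * (n / 2 ^ j)) (207 + 33 * D)
    (by simp [hI₁, h5, h19 j hjD.le, ho]) (by omega) (by simp; omega) (by simp; omega)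
    fun s₂ hI₂ hX₂ => ?_
  refine reaches_assign_seq g (189 + 117 * g + 18 * (n / 2 ^ j)) (189 + 33 * D)
    (by simp [hI₂, hI₁, h5, h19 (j + 1) hjD, ho, hg]) (by omega) (by simp; omega) (by simp; omega)
    fun s₃ hI₃ hX₃ => ?_
  have hsame : ∀ A, A ∉ [21, 23, 24] → s₃.ints A = s.ints A := fun A hA => by
    simp only [List.mem_cons, List.not_mem_nil, or_false, not_or] at hA
    simp [hI₃, hI₂, hI₁, hA]
  have hnum : s₃.nums = s.nums := by rw [hX₃, hX₂, hX₁]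
  have h23₃ : s₃.ints 23 0 = o := by simp [hI₃, hI₂]
  have h24₃ : s₃.ints 24 0 = g := by simp [hI₃]
  have h21₃ : s₃.ints 21 0 = j := by simp [hI₃, hI₂, hI₁]
  refine Reaches.mono (Reaches.seq (W₂ := 99 + 33 * g + 18 * (n / 2 ^ j)) (D₂ := 99 + 33 * D)
    (reaches_loadGroup (p := 2 ^ (j + 1)) (S := ∑ q ∈ Finset.range N, s.nums 0 (s.ints 13 q))
      (by rw [hsame 0 (by simp), h0]) (by rw [hsame 1 (by simp), h1]) (by rw [hnum, hzero])
      (by rw [hsame 22 (by simp), h22]) h23₃ h24₃ (by rw [hnum]; exact hnn) ?_ hS) ?_) ?_ ?_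
    fun I X h => h
  · rw [hnum, hsame 13 (by simp), hsame 20 (by simp), hg, ho,
      h20 j fun q => s.nums 0 (s.ints 13 q)]
    exact Finset.sum_le_sum_of_subset_of_nonneg (Finset.filter_subset _ _) fun _ _ _ => hnn _
  · rintro s₄ ⟨hI₄, hX₄, hsum₄, habs₄⟩
    rw [hnum, hsame 11 (by simp), hsame 12 (by simp), hsame 13 (by simp), hsame 3 (by simp),
      hsame 20 (by simp), hg, ho, h20 j, ← hg] at hsum₄
    refine reaches_assign_seq (g + 1) (91 + 33 * g + 18 * (n / 2 ^ j)) (91 + 33 * D)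
      (by simp [hI₄, h24₃]) (by omega) (by simp; omega) (by simp; omega) fun s₅ hI₅ hX₅ => ?_
    refine Reaches.mono (Reaches.seq (W₂ := 50 + 18 * (n / 2 ^ j)) (D₂ := 80)
      (reaches_reduce (len := g + 1) (by omega) (by simp [hI₅]) ?_ (by omega)) ?_) ?_ ?_
      fun I X h => h
    · rw [hX₅]
      exact habs₄.trans hS
    · rintro s₆ ⟨hI₆, hX₆, hsum₆⟩
      rw [hX₅, hsum₄] at hsum₆
      have hsame₆ : ∀ A, A ∉ [21, 23, 24] → s₆.ints A = s.ints A := fun A hA => by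
        rw [← hsame A hA]
        simp only [List.mem_cons, List.not_mem_nil, or_false, not_or] at hA
        rw [hI₆ A hA.2.2, hI₅, Function.update_of_ne hA.2.2, hI₄]
      have hnum₆ : ∀ A, A ≠ 2 → s₆.nums A = s.nums A := fun A hA => by
        rw [hX₆ A hA, hX₅, hX₄ A hA, hnum]
      obtain ⟨r, hr⟩ : ∃ r : ℕ, r = if ∑ q ∈ (Finset.range N).filter (fun q => key q = j),
        signedWeight (s.ints 11) (s.ints 12) (fun q => s.nums 0 (s.ints 13 q)) (s.ints 3)
          (2 ^ (j + 1)) q < 0 then 0 else 1 := ⟨_, rfl⟩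
      refine reaches_assign_seq r (40 + 18 * (n / 2 ^ j)) (60) ?_ ?_ (by simp; omega)
        (by simp) fun s₇ hI₇ hX₇ => ?_
      -- Only number array `2` has been written, so the first cell of number array `3` still holds
      -- the zero of the comparison.
      · simp only [Term.eval_ite, Term.eval_numLt, Term.eval_const, hsum₆,
          hnum₆ 3 (by simp), h3, hr, hkey]
        split_ifs <;> simp_all
      · rw [hr]; split_ifs <;> omega
      refine reaches_assign_seq (2 ^ j) (30 + 18 * (n / 2 ^ j)) (50) ?_ (by omega)
        (by simp; omega) (by simp) fun s₈ hI₈ hX₈ => ?_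
      · simp [hI₇, hsame₆, h22, hj2]
      have hsame₈ : ∀ A, A ∉ [21, 22, 23, 24, 26] → s₈.ints A = s.ints A := fun A hA => by
        simp only [List.mem_cons, List.not_mem_nil, or_false, not_or] at hA
        rw [hI₈, Function.update_of_ne hA.2.1, hI₇, Function.update_of_ne hA.2.2.2.2,
          hsame₆ A (by simp [hA])]
      have h22₈ : s₈.ints 22 0 = 2 ^ j := by simp [hI₈]
      have h26₈ : s₈.ints 26 0 = r := by simp [hI₈, hI₇]
      -- The table can be refined in place because all processors read the old memory. For `u < n`
      -- the index `u / 2 ^ j` may equal `n / 2 ^ j`, hence the extra cell.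
      refine (reaches_fill 3 _ _ _ (k := n / 2 ^ j + 1) (o := 0) ?_ (by simp)
        (refineLabel (s.ints 3) r) ?_ ?_).mono ?_ ?_ ?_
      · simp [hsame₈, h0, h22₈]
      · intro i hi
        simp [refineLabel, hsame₈, h26₈]
      · intro i hi
        exact (refineLabel_le _ _ _).trans (by omega)
      · simp; omega
      · simp
      · rintro I X ⟨rfl, rfl⟩
        refine ⟨fun A hA => ?_, fun A hA => ?_, ?_, ?_, fun x => ?_, ?_⟩
        · simp only [List.mem_cons, List.not_mem_nil, or_false, not_or] at hA
          rw [Function.update_of_ne hA.1, hsame₈ A (by simp [hA])]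
        · rw [hX₈, hX₇, hnum₆ A hA]
        · simp only [Function.update_of_ne (show (21 : ℕ) ≠ 3 by simp), hI₈,
            Function.update_of_ne (show (21 : ℕ) ≠ 22 by simp), hI₇,
            Function.update_of_ne (show (21 : ℕ) ≠ 26 by simp), hI₆ 21 (by simp), hI₅,
            Function.update_of_ne (show (21 : ℕ) ≠ 24 by simp), hI₄, h21₃]
        · rw [Function.update_of_ne (by simp), h22₈]
        · rw [Function.update_self]
          split_ifs
          · exact refineLabel_le _ _ _
          · rw [hsame₈ 3 (by simp)]; exact hT x
        · refine sum_signedWeight_refine hT hq ?_ hr hsum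
          have hlt : ∀ u < n, (0 ≤ u / 2 ^ j ∧ u / 2 ^ j < 0 + (n / 2 ^ j + 1)) := fun u hu =>
            ⟨Nat.zero_le _, by rw [zero_add]; exact div_lt_blocks hu⟩
          intro q hqN
          rw [Function.update_self, if_pos (hlt _ (hU q hqN).1), if_pos (hlt _ (hU q hqN).2)]
          simp
    · omega
    · omega
  · omega
  · omega

/-- All levels, from the highest bit difference to the lowest. -/
def Cmd.levels : Cmd :=
  .seq (.assign 21 (.reg 6)) <| .seq (.assign 22 (.reg 5)) <| .loop (.reg 21) .level

/-- The invariant at stage `k` concerns the keys from `k` on. It is an empty sum at stage `D`, as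
all keys are below `D`, and covers all positions at stage `0`. -/
theorem reaches_levels {n L N D : ℕ} (hN : 4 * N ≤ 2 ^ D) (hD : 2 ^ D ≤ M.wordBound)
    (hnN : n ≤ N)
    (h0 : s.ints 0 0 = n) (h1 : s.ints 1 n = L) (hzero : s.nums 0 L = 0) (h3 : s.nums 3 0 = 0)
    (h5 : s.ints 5 0 = 2 ^ D) (h6 : s.ints 6 0 = D)
    (h19 : ∀ j ≤ D, s.ints 19 (2 ^ D + j * s.ints 15 0) = countBelow N (s.ints 14) j)
    (h20 : ∀ j (g : ℕ → ℝ),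
        ∑ i ∈ Finset.range (countBelow N (s.ints 14) (j + 1) - countBelow N (s.ints 14) j),
          g (s.ints 20 (countBelow N (s.ints 14) j + i)) =
        ∑ q ∈ (Finset.range N).filter (fun q => s.ints 14 q = j), g q)
    (hU : ∀ q < N, s.ints 11 q < n ∧ s.ints 12 q < n)
    (hkeyD : ∀ q < N, s.ints 14 q < D)
    (hq : ∀ q < N, s.nums 0 (s.ints 13 q) = 0 ∨ s.ints 11 q ≠ s.ints 12 q ∧
      s.ints 14 q = padicValNat 2
        ((s.ints 11 q - s.ints 12 q) + (s.ints 12 q - s.ints 11 q)))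
    (hnn : ∀ x, 0 ≤ s.nums 0 x)
    (hS : ∑ q ∈ Finset.range N, s.nums 0 (s.ints 13 q) ≤ M.numBound)
    (hT : ∀ x, s.ints 3 x = 0) :
    Reaches M .levels s (14 + 270 * 2 ^ D) (14 + D * (230 + 33 * D)) (fun I _ =>
      (∀ x, I 3 x ≤ 1) ∧ ∑ q ∈ Finset.range N,
        signedWeight (s.ints 11) (s.ints 12) (fun q => s.nums 0 (s.ints 13 q)) (I 3) 1 q ≤ 0) := by
  have hDP : D < 2 ^ D := Nat.lt_two_pow_self
  have hgeom := Nat.geom_sum_le (b := 2) le_rfl n D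
  simp only [Nat.add_one_sub_one, Nat.div_one] at hgeom
  have hcN := countBelow_le (N := N) (key := s.ints 14) D
  refine reaches_assign_seq D (8 + 270 * 2 ^ D) (8 + D * (230 + 33 * D)) (by simp [h6]) (by omega)
    (by simp; omega) (by simp; omega) fun s₁ hI₁ hX₁ => ?_
  refine reaches_assign_seq (2 ^ D) (2 + 270 * 2 ^ D) (2 + D * (230 + 33 * D))
    (by simp [hI₁, h5]) (by omega) (by simp; omega) (by simp; omega) fun s₂ hI₂ hX₂ => ?_
  refine Reaches.mono (reaches_loop (k := D) (Inv := fun k I X => k ≤ D ∧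
      (∀ A, A ∉ [3, 21, 22, 23, 24, 26] → I A = s.ints A) ∧
        (∀ A, A ≠ 2 → X A = s.nums A) ∧ I 21 0 = k ∧ I 22 0 = 2 ^ k ∧ (∀ x, I 3 x ≤ 1) ∧
        ∑ q ∈ (Finset.range N).filter (fun q => k ≤ s.ints 14 q),
          signedWeight (s.ints 11) (s.ints 12) (fun q => s.nums 0 (s.ints 13 q)) (I 3)
            (2 ^ k) q ≤ 0)
    -- Group sizes are differences of `countBelow` and telescope to at most `N`, and the table sizes
    -- add up to at most `2 * n` by `hgeom`, apart from a constant per level.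
    (fun k => 2 + 230 * k + 117 * countBelow N (s.ints 14) k +
      18 * ∑ i ∈ Finset.range k, n / 2 ^ i)
    (fun k => 2 + k * (230 + 33 * D)) ?_ ?_ ?_) ?_ ?_ fun I X h => h
  · rintro k s' ⟨-, -, -, h21, -, hT', hsum⟩ hb
    obtain rfl : k = 0 := by simpa [h21] using hb
    exact ⟨by simp, by simp, hT', by simpa using hsum⟩
  · rintro k s' ⟨hk, hI, hX, h21, h22, hT', hsum⟩ hb
    obtain ⟨j, rfl⟩ : ∃ j, k = j + 1 :=
      Nat.exists_eq_succ_of_ne_zero (by rintro rfl; simp [h21] at hb)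
    refine ⟨j, by omega, _, _, (reaches_level (n := n) (L := L) (N := N) (D := D) (j := j)
      (by omega) hD hk ?_ ?_ ?_ ?_ ?_ ?_ ?_ ?_ ?_ ?_ ?_ hT' h21 h22 ?_).mono le_rfl le_rfl ?_,
      ?_, ?_⟩
    · rw [hI 0 (by simp), h0]
    · rw [hI 1 (by simp), h1]
    · rw [hX 0 (by simp), hzero]
    · rw [hX 3 (by simp), h3]
    · rw [hI 5 (by simp), h5]
    · rw [hI 19 (by simp), hI 15 (by simp), hI 14 (by simp)]
      exact h19
    · rw [hI 20 (by simp), hI 14 (by simp)]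
      exact h20
    · rw [hI 11 (by simp), hI 12 (by simp)]
      exact hU
    · rw [hI 11 (by simp), hI 12 (by simp), hI 13 (by simp), hI 14 (by simp), hX 0 (by simp)]
      exact hq
    · rw [hX 0 (by simp)]
      exact hnn
    · rw [hX 0 (by simp), hI 13 (by simp)]
      exact hS
    · rw [hI 11 (by simp), hI 12 (by simp), hI 13 (by simp), hI 14 (by simp), hX 0 (by simp)]
      exact hsum
    · rintro I X ⟨hI', hX', h21', h22', hT'', hsum'⟩
      rw [hI 11 (by simp), hI 12 (by simp), hI 13 (by simp), hI 14 (by simp), hX 0 (by simp)]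
        at hsum'
      exact ⟨by omega, fun A hA => (hI' A hA).trans (hI A hA),
        fun A hA => (hX' A hA).trans (hX A hA), h21', h22', hT'', hsum'⟩
    · have := countBelow_mono (N := N) (key := s.ints 14) (Nat.le_succ j)
      rw [hI 14 (by simp), Finset.sum_range_succ]
      simp only [Term.cost_reg, Nat.succ_eq_add_one] at this ⊢
      omega
    · rw [Nat.succ_mul j]
      simp only [Term.cost_reg]
      omega
  · refine ⟨le_rfl, fun A hA => ?_, fun A _ => by rw [hX₂, hX₁], by simp [hI₂, hI₁],
      by simp [hI₂], fun x => by simp [hI₂, hI₁, hT], ?_⟩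
    · simp only [List.mem_cons, List.not_mem_nil, or_false, not_or] at hA
      simp [hI₂, hI₁, hA]
    · rw [Finset.filter_false_of_mem fun q hq => not_le.2 (hkeyD q (Finset.mem_range.1 hq))]
      simp
  · omega
  · rfl

/-! ### The whole program on an abstract layout -/

/-- The maximum cut program: if `ε < 1` it cuts at least half of the weight. -/
def Cmd.maxCut : Cmd :=
  .ite (.numLt 1 (.const 0) 1 (.const 1))
    (.seq .init <| .seq .items <| .seq .sort .levels) .skip

theorem reaches_halfCut {n L N D : ℕ} (hL : IsLayout n L (s.ints 1) (s.ints 2))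
    (h0 : s.ints 0 0 = n) (hn : 0 < n) (hN : L + n = N) (hD : 0 < D) (h4D : 4 * N ≤ 2 ^ D)
    (hD8 : 2 ^ D < 8 * N) (hP : 8 * N ≤ M.wordBound)
    (hfresh : ∀ A, 3 ≤ A → ∀ x, s.ints A x = 0) (hzero : s.nums 0 L = 0) (h3 : s.nums 3 0 = 0)
    (hnn : ∀ x, 0 ≤ s.nums 0 x)
    (hloop : ∀ u < n, ∀ i < s.ints 1 (u + 1) - s.ints 1 u, s.ints 2 (s.ints 1 u + i) ≠ u)
    (hS : ∑ u ∈ Finset.range n, ∑ i ∈ Finset.range (s.ints 1 (u + 1) - s.ints 1 u),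
      s.nums 0 (s.ints 1 u + i) ≤ M.numBound) :
    Reaches M (.seq .init <| .seq .items <| .seq .sort .levels) s (900 * 2 ^ D) (900 * D ^ 2)
      (fun I _ => (∀ x, I 3 x ≤ 1) ∧
        ∑ u ∈ Finset.range n, ∑ i ∈ Finset.range (s.ints 1 (u + 1) - s.ints 1 u),
          (if I 3 u = I 3 (s.ints 2 (s.ints 1 u + i)) then s.nums 0 (s.ints 1 u + i)
            else -s.nums 0 (s.ints 1 u + i)) ≤ 0) := by
  have hDD : D ≤ D * D := Nat.le_mul_self D
  have hPD : 2 ^ D ≤ M.wordBound := by omega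
  have e1 : D * (230 + 33 * D) = 230 * D + 33 * (D * D) := by ring
  have e2 : 900 * D ^ 2 = 900 * (D * D) := by ring
  refine Reaches.mono (Reaches.seq (W₂ := 84 + 670 * 2 ^ D) (D₂ := 204 + 550 * D + 33 * (D * D))
    (reaches_init (N := N) (D := D) h0 (by rw [hL.last]; omega) h4D hD8 (hfresh 6 (by simp) 0)
      (hfresh 7 (by simp) 0) hP) ?_) (by omega) (by omega) fun I X h => h
  rintro s₁ ⟨hX₁, hI₁, h4₁, h5₁, h6₁, h7₁⟩
  refine Reaches.mono (Reaches.seq (W₂ := 54 + 520 * 2 ^ D) (D₂ := 74 + 440 * D + 33 * (D * D))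
    (reaches_items (n := n) (L := L) (N := N) (D := D)
      (by rw [hI₁ 1 (by simp), hI₁ 2 (by simp)]; exact hL) (by rw [hI₁ 0 (by simp), h0]) hN h4D hn
      h4₁ h5₁ h7₁ (by rw [hI₁ 8 (by simp)]; exact hfresh 8 (by simp))
      (by rw [hI₁ 9 (by simp)]; exact hfresh 9 (by simp) 1) hPD) ?_) (by omega) (by omega)
    fun I X h => h
  rintro s₂ ⟨hX₂, hI₂, hpos, hkey⟩
  rw [hI₁ 1 (by simp), hI₁ 2 (by simp)] at hpos
  have hs₂ : ∀ A, A ∉ [4, 5, 6, 7, 8, 9, 10, 11, 12, 13, 14] → s₂.ints A = s.ints A :=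
    fun A hA => by
      simp only [List.mem_cons, List.not_mem_nil, or_false, not_or] at hA
      rw [hI₂ A (by simp [hA]), hI₁ A (by simp [hA])]
  have hkeyD : ∀ q < N, s₂.ints 14 q < D := fun q hq => by
    obtain ⟨h1, h2, h3⟩ := hkey q hq
    rw [h3]
    exact padicValNat_two_lt hD (by omega)
  refine Reaches.mono (Reaches.seq (W₂ := 14 + 270 * 2 ^ D) (D₂ := 14 + D * (230 + 33 * D))
    (reaches_sort (N := N) (D := D) hD (by omega) h4D (by rw [hI₂ 4 (by simp), h4₁])
      (by rw [hI₂ 5 (by simp), h5₁]) (by rw [hI₂ 6 (by simp), h6₁])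
      (by rw [hs₂ 16 (by simp)]; exact hfresh 16 (by simp) 0)
      (by rw [hs₂ 18 (by simp)]; exact hfresh 18 (by simp))
      (by rw [hs₂ 19 (by simp)]; exact hfresh 19 (by simp) 1) hkeyD hPD) ?_) (by omega) (by omega)
    fun I X h => h
  rintro s₃ ⟨hX₃, hI₃, h19, h20⟩
  have hs₃ : ∀ A, A ∉ [4, 5, 6, 7, 8, 9, 10, 11, 12, 13, 14, 15, 16, 17, 18, 19, 20] →
      s₃.ints A = s.ints A := fun A hA => by
    simp only [List.mem_cons, List.not_mem_nil, or_false, not_or] at hA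
    rw [hI₃ A (by simp [hA]), hs₂ A (by simp [hA])]
  have hnum : s₃.nums = s.nums := by rw [hX₃, hX₂, hX₁]
  have h14 := hI₃ 14 (by simp)
  have h11 := hI₃ 11 (by simp)
  have h12 := hI₃ 12 (by simp)
  have h13 := hI₃ 13 (by simp)
  -- Heads have weight zero, so sums over positions reduce to sums over adjacency entries.
  have hsumN : ∀ F : ℕ → ℝ, (∀ q, s.nums 0 (s₂.ints 13 q) = 0 → F q = 0) →
      ∑ q ∈ Finset.range N, F q = ∑ u ∈ Finset.range n,
        ∑ i ∈ Finset.range (s.ints 1 (u + 1) - s.ints 1 u), F (s.ints 1 u + u + 1 + i) := by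
    intro F hF
    have h := hL.sum_range F le_rfl
    rw [hL.last, hN] at h
    rw [h]
    refine Finset.sum_congr rfl fun u hu => ?_
    rw [hF _ (by rw [(hpos u (Finset.mem_range.1 hu)).1, hzero]), zero_add]
  rw [← h14] at h19 h20
  refine (reaches_levels (n := n) (L := L) (N := N) (D := D) h4D hPD (by omega)
    (by rw [hs₃ 0 (by simp), h0]) (by rw [hs₃ 1 (by simp), hL.last]) (by rw [hnum, hzero])
    (by rw [hnum, h3]) (by rw [hI₃ 5 (by simp), hI₂ 5 (by simp), h5₁])
    (by rw [hI₃ 6 (by simp), hI₂ 6 (by simp), h6₁]) h19 h20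
    (by rw [h11, h12]; exact fun q hq => ⟨(hkey q hq).1, (hkey q hq).2.1⟩)
    (by rw [h14]; exact hkeyD) ?_ (by rw [hnum]; exact hnn) ?_
    (by rw [hs₃ 3 (by simp)]; exact hfresh 3 (by simp))).mono le_rfl le_rfl ?_
  · rw [h11, h12, h13, h14, hnum]
    intro q hq
    obtain ⟨u, hu, rfl | ⟨i, hi, rfl⟩⟩ :=
      hL.exists_eq le_rfl (q := q) (by rw [hL.last, hN]; exact hq)
    · rw [(hpos u hu).1]
      exact .inl hzero
    · refine .inr ⟨?_, (hkey _ hq).2.2⟩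
      rw [((hpos u hu).2 i hi).1, ((hpos u hu).2 i hi).2.1]
      exact (hloop u hu i hi).symm
  · rw [hnum, h13, hsumN _ fun q h => h]
    refine le_of_eq_of_le (Finset.sum_congr rfl fun u hu => Finset.sum_congr rfl fun i hi => ?_) hS
    rw [((hpos u (Finset.mem_range.1 hu)).2 i (Finset.mem_range.1 hi)).2.2]
  · rintro I X ⟨hT, hsum⟩
    refine ⟨hT, le_of_eq_of_le ?_ hsum⟩
    rw [h11, h12, h13, hnum, hsumN _ fun q h => by simp [signedWeight, h]]
    refine Finset.sum_congr rfl fun u hu => Finset.sum_congr rfl fun i hi => ?_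
    obtain ⟨e1, e2, e3⟩ := (hpos u (Finset.mem_range.1 hu)).2 i (Finset.mem_range.1 hi)
    simp only [signedWeight, e1, e2, e3, Nat.div_one]

/-! ### Reading the input memory -/

theorem getD_flatten {α : Type*} (l : List (List α)) (d : α) {u : ℕ} (hu : u < l.length) {i : ℕ}
    (hi : i < l[u].length) :
    l.flatten.getD (((l.map List.length).take u).sum + i) d = l[u][i] := by
  induction l generalizing u with
  | nil => simp at hu
  | cons a l ih =>
    cases u with
    | zero =>
      simp only [List.getElem_cons_zero] at hi
      simp [List.getElem?_append_left hi, List.getD_eq_getElem?_getD, hi]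
    | succ u =>
      simp only [List.getElem_cons_succ] at hi ⊢
      rw [← ih (by simpa using hu) hi]
      simp [List.getD_eq_getElem?_getD, add_assoc, List.getElem?_append_right]

theorem getD_mem_or {α : Type*} (l : List α) (d : α) (x : ℕ) : l.getD x d ∈ l ∨ l.getD x d = d := by
  rw [List.getD_eq_getElem?_getD]
  rcases lt_or_ge x l.length with h | h
  · left; simp [h]
  · right; simp [h]

section input
variable {n : ℕ} (adj : Fin n → List (Fin n)) (w : Sym2 (Fin n) → ℝ) (ε : ℝ)

theorem input_start {x : ℕ} (hx : x ≤ n) :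
    (inputState adj w ε).ints 1 x = ((List.ofFn fun v => (adj v).length).take x).sum := by
  simp only [inputState, hx]
  rw [List.length_flatten, List.map_take, List.map_ofFn]
  simp [Function.comp_def]

theorem input_start_succ (u : Fin n) :
    (inputState adj w ε).ints 1 (u + 1) = (inputState adj w ε).ints 1 u + (adj u).length := by
  rw [input_start adj w ε u.2, input_start adj w ε u.2.le, List.sum_take_succ _ _ (by simp)]
  simp

theorem input_deg (u : Fin n) :
    (inputState adj w ε).ints 1 (u + 1) - (inputState adj w ε).ints 1 u = (adj u).length := by
  rw [input_start_succ, Nat.add_sub_cancel_left]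

theorem input_target (u : Fin n) {i : ℕ} (hi : i < (adj u).length) :
    (inputState adj w ε).ints 2 ((inputState adj w ε).ints 1 u + i) = (adj u)[i] := by
  rw [input_start adj w ε u.2.le]
  simp only [inputState, OfNat.ofNat_ne_zero, false_and, if_false, OfNat.ofNat_ne_one, if_true]
  have h := getD_flatten ((List.ofFn adj).map (List.map Fin.val)) 0 (u := u) (by simp) (i := i)
    (by simpa using hi)
  rw [← List.map_flatten, List.map_map, List.map_ofFn] at h
  simpa [Function.comp_def] using h

theorem input_weight (u : Fin n) {i : ℕ} (hi : i < (adj u).length) :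
    (inputState adj w ε).nums 0 ((inputState adj w ε).ints 1 u + i) = w s(u, (adj u)[i]) := by
  rw [input_start adj w ε u.2.le]
  simp only [inputState, if_true]
  have h := getD_flatten (List.ofFn fun v => (adj v).map fun u => w s(v, u)) 0 (u := u) (by simp)
    (i := i) (by simpa using hi)
  rw [List.map_ofFn] at h
  simpa [Function.comp_def] using h

theorem input_weight_nonneg {G : SimpleGraph (Fin n)} [DecidableRel G.Adj]
    (hadj : IsAdjacencyLists G adj) (hw : ∀ e ∈ G.edgeFinset, 0 ≤ w e) (x : ℕ) :
    0 ≤ (inputState adj w ε).nums 0 x := by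
  simp only [inputState, if_true]
  rcases getD_mem_or (List.ofFn fun v => (adj v).map fun u => w s(v, u)).flatten 0 x with h | h
  · obtain ⟨l, hl, hx⟩ := List.mem_flatten.1 h
    obtain ⟨v, rfl⟩ := (List.mem_ofFn' _ _).1 hl
    obtain ⟨u, hu, hx⟩ := List.mem_map.1 hx
    rw [← hx]
    exact hw _ (by simpa using ((hadj v).2 u).1 hu)
  · rw [h]

theorem input_isLayout (hn : 0 < n) :
    IsLayout n ((inputState adj w ε).ints 1 n) ((inputState adj w ε).ints 1)
      ((inputState adj w ε).ints 2) where
  zero := by rw [input_start adj w ε (Nat.zero_le n)]; simp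
  last := rfl
  step u hu := by
    have := input_start_succ adj w ε ⟨u, hu⟩
    simp only at this
    omega
  lt x _ := by
    simp only [inputState, OfNat.ofNat_ne_zero, false_and, if_false, OfNat.ofNat_ne_one, if_true]
    rcases getD_mem_or ((List.ofFn adj).flatten.map Fin.val) 0 x with h | h
    · obtain ⟨v, -, hv⟩ := List.mem_map.1 h
      rw [← hv]
      exact v.2
    · rw [h]
      exact hn

theorem input_total : (inputState adj w ε).ints 1 n = ∑ u, (adj u).length := by
  rw [input_start adj w ε le_rfl, List.take_of_length_le (by simp), List.sum_ofFn]

/-- The first cell after the weights has the default value, and the program uses it as its zero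
weight. -/
theorem input_weight_total : (inputState adj w ε).nums 0 ((inputState adj w ε).ints 1 n) = 0 := by
  have h : (List.ofFn fun v => (adj v).map fun u => w s(v, u)).flatten.length =
      (inputState adj w ε).ints 1 n := by
    rw [List.length_flatten, List.map_ofFn, List.sum_ofFn, input_total]
    simp
  rw [← h]
  simp [inputState, List.getD_eq_getElem?_getD]

end input

/-! ### From sums over adjacency lists to cuts -/

section graph

variable {n : ℕ} {G : SimpleGraph (Fin n)} [DecidableRel G.Adj]

/-- Both sides are the sum over darts, grouped by first vertex or by edge; each edge carries two
darts. -/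
theorem sum_adj_eq_two_mul_sum_edges (h : Sym2 (Fin n) → ℝ) :
    ∑ u, ∑ v ∈ G.neighborFinset u, h s(u, v) = 2 * ∑ e ∈ G.edgeFinset, h e := by
  have h1 : ∑ d : G.Dart, h d.edge = 2 * ∑ e ∈ G.edgeFinset, h e := by
    rw [← Finset.sum_fiberwise_of_maps_to (s := Finset.univ) (t := G.edgeFinset)
      (g := fun d : G.Dart => d.edge) (fun d _ => by simp), Finset.mul_sum]
    refine Finset.sum_congr rfl fun e he => ?_
    rw [Finset.sum_congr rfl (g := fun _ => h e) fun d hd => by rw [(Finset.mem_filter.1 hd).2],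
      Finset.sum_const, G.dart_edge_fiber_card e (by simpa using he)]
    simp
  rw [← h1, ← Finset.sum_fiberwise (s := Finset.univ) (g := fun d : G.Dart => d.fst)]
  refine Finset.sum_congr rfl fun u _ => ?_
  rw [G.dart_fst_fiber u, Finset.sum_image fun x _ y _ h => G.dartOfNeighborSet_injective u h]
  exact (Finset.sum_subtype (p := fun v => v ∈ G.neighborSet u) (G.neighborFinset u) (by simp)
    fun v => h s(u, v))

/-- Taking `h` to be `1`, the weight, and the signed weight yields the length `2m` of the lists, the
bound on stored numbers, and the guarantee for the cut. -/
theorem sum_adjacency {adj : Fin n → List (Fin n)} (hadj : IsAdjacencyLists G adj)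
    (h : Sym2 (Fin n) → ℝ) (F : ℕ → ℕ → ℝ)
    (hF : ∀ (u : Fin n) i (hi : i < (adj u).length), F u i = h s(u, (adj u)[i])) (len : ℕ → ℕ)
    (hlen : ∀ u : Fin n, len u = (adj u).length) :
    ∑ u ∈ Finset.range n, ∑ i ∈ Finset.range (len u), F u i = 2 * ∑ e ∈ G.edgeFinset, h e := by
  rw [← sum_adj_eq_two_mul_sum_edges, Finset.sum_range]
  refine Finset.sum_congr rfl fun u _ => ?_
  have h1 : G.neighborFinset u = (adj u).toFinset := by
    ext v
    simp [(hadj u).2 v]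
  rw [h1, List.sum_toFinset _ (hadj u).1, hlen, Finset.sum_range, ← Fin.sum_univ_fun_getElem]
  exact Finset.sum_congr rfl fun i _ => hF u i i.2

/-- The signed weight of an edge is its weight minus twice its contribution to the cut. -/
theorem half_le_cutWeight (w : Sym2 (Fin n) → ℝ) {T : ℕ → ℕ} (hT : ∀ x, T x ≤ 1)
    (S : Finset (Fin n)) (hS : ∀ v, v ∈ S ↔ T v = 1) (h : Sym2 (Fin n) → ℝ)
    (hh : ∀ u v : Fin n, h s(u, v) = if T u = T v then w s(u, v) else -w s(u, v))
    (hsum : ∑ e ∈ G.edgeFinset, h e ≤ 0) :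
    1 / 2 * ∑ e ∈ G.edgeFinset, w e ≤ cutWeight G w S := by
  classical
  have hcut : ∀ e : Sym2 (Fin n),
      h e = w e - 2 * if (∃ u ∈ S, ∃ v ∉ S, e = s(u, v)) then w e else 0 := by
    intro e
    induction e with | _ u v
    have hiff : (∃ u' ∈ S, ∃ v' ∉ S, s(u, v) = s(u', v')) ↔ T u ≠ T v := by
      have h1 := hT u
      have h2 := hT v
      constructor
      · rintro ⟨u', hu', v', hv', he⟩
        rw [hS] at hu' hv'
        rcases Sym2.eq_iff.1 he with ⟨rfl, rfl⟩ | ⟨rfl, rfl⟩ <;> omega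
      · intro hne
        by_cases hu : T u = 1
        · exact ⟨u, (hS u).2 hu, v, fun hv => hne (hu.trans ((hS v).1 hv).symm), rfl⟩
        · exact ⟨v, (hS v).2 (by omega), u, fun hu' => hu ((hS u).1 hu'), Sym2.eq_swap⟩
    rw [hh]
    by_cases he : T u = T v
    · rw [if_pos he, if_neg (by rw [hiff]; simpa using he)]; ring
    · rw [if_neg he, if_pos (hiff.2 he)]; ring
  rw [Finset.sum_congr rfl fun e _ => hcut e, Finset.sum_sub_distrib, ← Finset.mul_sum,
    ← Finset.sum_filter] at hsum
  rw [cutWeight]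
  linarith

end graph

/-! ### Constants and the main theorem -/

theorem pow_bound_log {n D : ℕ} (hn : 0 < n) (h : 2 ^ D < 16 * n ^ 2) :
    (D : ℝ) ≤ 4 * (1 + Real.log n) := by
  have hn' : (0 : ℝ) < n := by exact_mod_cast hn
  have h1 : (2 : ℝ) ^ D ≤ 2 ^ 4 * (n : ℝ) ^ 2 := by
    norm_num
    exact_mod_cast h.le
  have h2 := Real.log_le_log (by positivity) h1
  rw [Real.log_mul (by positivity) (by positivity), Real.log_pow, Real.log_pow, Real.log_pow] at h2
  have h3 : 0 ≤ Real.log n := Real.log_natCast_nonneg n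
  have h4 := Real.log_two_gt_d9
  push_cast at h2
  by_contra! h5
  nlinarith

end WorkDepth

open WorkDepth in
theorem mainTheorem9 :
    ∃ (prog : WorkDepth.Cmd) (C c : ℕ),
      ∀ (n : ℕ) (_hn : 0 < n) (G : SimpleGraph (Fin n)) [DecidableRel G.Adj]
        (adj : Fin n → List (Fin n)) (_hadj : WorkDepth.IsAdjacencyLists G adj)
        (w : Sym2 (Fin n) → ℝ) (_hw : ∀ e ∈ G.edgeFinset, 0 ≤ w e)
        (ε : ℝ) (_hε : 0 < ε) (σ : WorkDepth.Arbiter),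
        ∃ s : WorkDepth.State,
          WorkDepth.Exec
            { wordBound := C * n ^ c
              numBound := C * (n : ℝ) ^ c * (1 + ε + ∑ e ∈ G.edgeFinset, w e)
              arbiter := σ }
            prog (WorkDepth.inputState adj w ε) s ∧
          (1 / 2 - ε) * ∑ e ∈ G.edgeFinset, w e ≤ cutWeight G w (WorkDepth.outputSet n s) ∧
          (s.work : ℝ) ≤
            C * ((G.edgeFinset.card : ℝ) + n) * max 1 (Real.log (Real.log n)) ∧
          (s.depth : ℝ) ≤ C * (1 + Real.log n / ε) ^ c := by
  -- Work is at most `3 + 900 * 2 ^ D` with `2 ^ D < 8 * (2 * m + n)`, and depth at most `3 + 900 *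
  -- D ^ 2` with `D ≤ 4 * (1 + log n)`. The leading constants are both `14400`.
  refine ⟨.maxCut, 15000, 2, ?_⟩
  intro n hn G _ adj hadj w hw ε hε σ
  set W := ∑ e ∈ G.edgeFinset, w e with hW
  have hW0 : 0 ≤ W := Finset.sum_nonneg hw
  have hn1 : (1 : ℝ) ≤ n := by exact_mod_cast hn
  have hlog : 0 ≤ Real.log n := Real.log_natCast_nonneg n
  have hmax : 1 ≤ max 1 (Real.log (Real.log n)) := le_max_left _ _
  have hcard : (0 : ℝ) ≤ G.edgeFinset.card := Nat.cast_nonneg _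
  set s₀ := inputState adj w ε with hs₀
  have hε0 : s₀.nums 1 0 = ε := by simp [hs₀, inputState]
  have hone : s₀.nums 1 1 = 1 := by simp [hs₀, inputState]
  -- For `ε ≥ 1` the required weight is nonpositive, so any output is good enough, while the depth
  -- bound could be too small for the full program.
  by_cases hε1 : ε < 1
  · have hL := input_isLayout adj w ε hn
    rw [← hs₀] at hL
    obtain ⟨L, hLdef⟩ : ∃ L, L = s₀.ints 1 n := ⟨_, rfl⟩
    rw [← hLdef] at hL
    have hdeg : ∀ u : Fin n, s₀.ints 1 (u + 1) - s₀.ints 1 u = (adj u).length :=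
      input_deg adj w ε
    have hLn : L ≤ n * n := by
      rw [hLdef, hs₀, input_total]
      refine (Finset.sum_le_sum fun u _ => ((hadj u).1.length_le_card)).trans ?_
      simp
    have hLm : (L : ℝ) = 2 * G.edgeFinset.card := by
      rw [hLdef, hs₀, input_total]
      have h := sum_adjacency hadj (fun _ => 1) (fun _ _ => 1) (fun _ _ _ => rfl) (fun u => s₀.ints 1 (u + 1) - s₀.ints 1 u) hdeg
      rw [Finset.sum_range] at h
      simp only [hdeg] at h
      simpa using h
    obtain ⟨D, hD, h4D, hD8⟩ := exists_two_pow (N := L + n) (by omega)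
    have hN2 : L + n ≤ 2 * n ^ 2 := by nlinarith
    have hS := sum_adjacency hadj w (fun u i => s₀.nums 0 (s₀.ints 1 u + i))
      (fun u i hi => input_weight adj w ε u hi) (fun u => s₀.ints 1 (u + 1) - s₀.ints 1 u) hdeg
    obtain ⟨s, hex, hwork, hdepth, hT, hsum⟩ := reaches_halfCut (n := n) (L := L) (N := L + n)
      (M := { wordBound := 15000 * n ^ 2
              numBound := (15000 : ℕ) * (n : ℝ) ^ 2 * (1 + ε + W)
              arbiter := σ })
      (s := s₀.charge (.numLt 1 (.const 0) 1 (.const 1)))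
      (D := D) hL (by simp [State.charge, hs₀, inputState]) hn rfl hD h4D hD8
      (by simp only; omega)
      (fun A hA x => by
        simp only [State.charge, hs₀, inputState]
        rw [if_neg (by omega), if_neg (by omega), if_neg (by omega)])
      (by rw [hLdef]; exact input_weight_total adj w ε)
      (by simp [State.charge, hs₀, inputState])
      (input_weight_nonneg adj w ε hadj hw)
      (fun u hu i hi => by
        simp only [State.charge] at hi ⊢
        have hi' : i < (adj ⟨u, hu⟩).length := by rw [← hdeg]; exact hi
        have h := input_target adj w ε ⟨u, hu⟩ hi'
        simp only at h
        rw [hs₀, h]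
        intro heq
        have hmem := ((hadj ⟨u, hu⟩).2 _).1 (List.getElem_mem hi')
        exact hmem.ne (Fin.ext heq.symm))
      (by
        refine le_of_eq_of_le hS ?_
        simp only [← hW]
        have h1 : (1 : ℝ) ≤ (n : ℝ) ^ 2 := one_le_pow₀ hn1
        push_cast
        nlinarith)
    refine ⟨s, .iteTrue ?_ hex, ?_, ?_, ?_⟩
    · simp [hε0, hone, hε1]
    -- The signed weight is symmetric in the ends, so it descends to unordered pairs.
    · obtain ⟨h, hh⟩ : ∃ h : Sym2 (Fin n) → ℝ, ∀ u v : Fin n, h s(u, v) =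
          if s.ints 3 u = s.ints 3 v then w s(u, v) else -w s(u, v) := ⟨Sym2.lift ⟨fun u v : Fin n =>
          if s.ints 3 u = s.ints 3 v then w s(u, v) else -w s(u, v), fun u v => by
            simp only [Sym2.eq_swap (a := u), eq_comm (a := s.ints 3 u)]⟩, fun u v => rfl⟩
      have hsum' := sum_adjacency hadj h (fun u i =>
        if s.ints 3 u = s.ints 3 (s₀.ints 2 (s₀.ints 1 u + i)) then s₀.nums 0 (s₀.ints 1 u + i)
            else -s₀.nums 0 (s₀.ints 1 u + i)) (fun u i hi => by
          rw [hh, hs₀, input_weight adj w ε u hi, input_target adj w ε u hi]) (fun u => s₀.ints 1 (u + 1) - s₀.ints 1 u) hdeg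
      have hhalf := half_le_cutWeight (G := G) w hT (outputSet n s)
        (fun v => by simp [outputSet]) _ hh (by
          have := hsum'.symm.trans_le hsum
          linarith)
      refine le_trans ?_ hhalf
      rw [← hW]
      nlinarith
    · have h1 : s.work ≤ 15000 * (G.edgeFinset.card + n) := by
        have h2 : L = 2 * G.edgeFinset.card := by exact_mod_cast hLm
        simp only [State.charge, hs₀, inputState, Term.cost_numLt, Term.cost_const] at hwork
        omega
      have h2 : (s.work : ℝ) ≤ 15000 * (G.edgeFinset.card + n) := by exact_mod_cast h1
      refine h2.trans ?_
      push_cast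
      -- The work is already linear; the doubly logarithmic factor enters only through being at
      -- least `1`.
      exact le_mul_of_one_le_right (by positivity) hmax
    · have h1 : s.depth ≤ 3 + 900 * D ^ 2 := by
        simp only [State.charge, hs₀, inputState, Term.cost_numLt, Term.cost_const] at hdepth
        omega
      have h2 : (s.depth : ℝ) ≤ 3 + 900 * (D : ℝ) ^ 2 := by exact_mod_cast h1
      have h3 := pow_bound_log (n := n) (D := D) hn (by omega)
      have h4 : Real.log n ≤ Real.log n / ε := by
        rw [le_div_iff₀ hε]
        nlinarith
      have h5 : (D : ℝ) ^ 2 ≤ (4 * (1 + Real.log n / ε)) ^ 2 :=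
        pow_le_pow_left₀ (by positivity) (by linarith) 2
      have h6 : (1 : ℝ) ≤ (1 + Real.log n / ε) ^ 2 := one_le_pow₀ (by linarith)
      push_cast
      nlinarith
  · refine ⟨_, .iteFalse ?_ (.skip _), ?_, ?_, ?_⟩
    · simp [hε0, hone, hε1]
    · refine le_trans (mul_nonpos_of_nonpos_of_nonneg (by linarith) hW0) ?_
      exact Finset.sum_nonneg fun e he => hw e (Finset.mem_filter.1 he).1
    · simp only [State.charge, hs₀, inputState, Term.cost_numLt, Term.cost_const]
      push_cast
      have : (1 : ℝ) ≤ (G.edgeFinset.card + n) * max 1 (Real.log (Real.log n)) :=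
        one_le_mul_of_one_le_of_one_le (by linarith) hmax
      linarith
    · simp only [State.charge, hs₀, inputState, Term.cost_numLt, Term.cost_const]
      have : (1 : ℝ) ≤ (1 + Real.log n / ε) ^ 2 := one_le_pow₀ (by
        have := div_nonneg hlog hε.le
        linarith)
      push_cast
      linarith
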